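/- **Machine model.** Let $m,n\ge 1$ with $mn\ge 2$, and let words have $W=\kappa(\lfloor\log_2(mn)\rfloor+1)$ bits for an integer constant $\kappa\ge 1$. A memory consists of cells, each holding a word or a real number; all cells are initially blank (zero). Its size is $W$ bits times the number of cells in use, i.e. a real number is counted as one word; the cells of each of the two kinds are counted up to the last non-blank one. Classical programs are random access programs (independent of $m,n$ and of the data, which are given as inputs) with the usual operations on $W$-bit words, moves, $+,-,\times,<$ on real numbers, and indirect addressing by words. Quantum algorithms are sequences of instructions on $W$-qubit word registers and on registers holding numbers, issued by a classical program that knows $m,n,W$ but not the stored data. The instructions are: reversible word operations $|d\rangle|a\rangle|b\rangle\mapsto|d\oplus f(a,b)\rangle|a\rangle|b\rangle$, XOR with a constant, quantum queries $|d\rangle|a\rangle\mapsto|d\oplus M[a]\rangle|a\rangle$ and $|x\rangle|a\rangle\mapsto|x\pm M[a]\rangle|a\rangle$ to the two kinds of cells of the memory, the rotation of a qubit $|0\rangle\mapsto(\sqrt X|0\rangle+\sqrt Y|1\rangle)/\sqrt{X+Y}$, $|1\rangle\mapsto(-\sqrt Y|0\rangle+\sqrt X|1\rangle)/\sqrt{X+Y}$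 conditioned on registers holding $X,Y\ge0$, $X+Y>0$, and a sign flip conditioned on a register holding a negative number. Every classical or quantum instruction takes time $W$. For a nonzero real vector $x$, $|x\rangle=\frac1{\|x\|}\sum_k x_k|k\rangle$. **Theorem.** There are a constant $\kappa$, a data structure (an insertion program acting on an initially blank memory) and two programs controlling quantum algorithms, such that the following holds for all $m,n$ with $mn\ge2$ and all finite sequences of arriving entries $(i,j,a)$, $i\in[m]$, $j\in[n]$, $a\in\mathbb R$, in arbitrary order. Let $A\in\mathbb R^{m\times n}$ be the matrix currently stored (the last value that arrived at each position, and $0$ where nothing arrived), and let $w$ be the number of positions $(i,j)$ whose entry has arrived. All constants, including those in the $O(\cdot)$ and $\mathrm{polylog}$, are independent of $m$, $n$ and the entries. 1. The size of the data structure is $O(w\log^2(mn))$. Moreover, if every arrived value has the form $z/2^s$ with an integer $|z|<2^b$, then every real number held in the memory has the form $z'/2^{s'}$ with $s'\le 2s$ and an integer $|z'|<2^{b'}$, where $b'=O(b+\log(mn))$. 2. The time to store a new entry $(i,j,a)$ is $O(\log^2(mn))$. 3. With quantum access to the data structure, the two quantum algorithms perform, in time $\mathrm{polylog}(mn)$,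 the mappings $\widetilde U:|i\rangle|0\rangle\mapsto|i\rangle|A_i\rangle$ for every $i\in[m]$ such that the row $A_i$ of $A$ is not zero, and, if $A\ne0$, $\widetilde V:|0\rangle|j\rangle\mapsto|\widetilde A\rangle|j\rangle$ for every $j\in[n]$, where $\widetilde A\in\mathbb R^m$ has entries $\widetilde A_i=\|A_i\|$. Both mappings are exact, and all work registers start and end in the zero state. -/

import Mathlib

/-!
# Storing a matrix so that its rows can be prepared as quantum states

Two machine models are defined.

* A classical random access machine with `W`-bit words, words that hold real numbers, and a
  persistent memory.  Integers are reduced modulo `2 ^ W`.  Real numbers can be moved, added,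
  subtracted, multiplied and compared; they cannot be rounded or used as addresses.  Programs are
  finite texts, independent of all sizes.
* A quantum machine whose basis states are assignments of values to registers, with quantum
  queries to a classical memory and with rotations conditioned on numbers held in registers.
  Its instructions are issued one after the other by a program of the classical machine.

An instruction of either machine acts on a bounded number of words and is charged `W` units
of time, the time it takes to write down one word.
-/

noncomputable section

namespace QDS

/-! ### Words, memory, instructions -/

/-- Elementary operations on words. -/
inductive WordOp
  | add | sub | mul | and | or | xor | shl | shr | eq | lt

/-- All operations are those of `W`-bit machine words; tests return `1` (true) or `0` (false). -/
def WordOp.eval {W : ℕ} : WordOp → BitVec W → BitVec W → BitVec W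
  | .add, x, y => x + y
  | .sub, x, y => x - y
  | .mul, x, y => x * y
  | .and, x, y => x &&& y
  | .or, x, y => x ||| y
  | .xor, x, y => x ^^^ y
  | .shl, x, y => x <<< y.toNat
  | .shr, x, y => x >>> y.toNat
  | .eq, x, y => if x.toNat = y.toNat then 1#W else 0#W
  | .lt, x, y => if x.toNat < y.toNat then 1#W else 0#W

/-- Elementary operations on real numbers. -/
inductive RealOp
  | add | sub | mul

def RealOp.eval : RealOp → ℝ → ℝ → ℝ
  | .add, x, y => x + y
  | .sub, x, y => x - y
  | .mul, x, y => x * y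

/-- A classical memory: `2 ^ W` cells for words and `2 ^ W` cells for real numbers. -/
structure Memory (W : ℕ) where
  word : BitVec W → BitVec W
  real : BitVec W → ℝ

/-- The blank memory. -/
def Memory.blank (W : ℕ) : Memory W := ⟨fun _ => 0#W, fun _ => 0⟩

/-- The number of word cells in use: the length of the shortest initial segment of the memory
outside of which all word cells are blank. -/
def Memory.wordCells {W : ℕ} (M : Memory W) : ℕ :=
  sInf {k : ℕ | ∀ a : BitVec W, k ≤ a.toNat → M.word a = 0#W}

/-- The number of real cells in use, counted in the same way. -/
def Memory.realCells {W : ℕ} (M : Memory W) : ℕ :=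
  sInf {k : ℕ | ∀ a : BitVec W, k ≤ a.toNat → M.real a = 0}

/-- The size of a memory in bits, every cell in use counting as one word of `W` bits. -/
def Memory.size {W : ℕ} (M : Memory W) : ℕ := (M.wordCells + M.realCells) * W

/-- Instructions of the quantum machine.  `d`, `a`, `b`, `r` are names of word registers,
`x`, `y` are names of real registers; the meaning is given by `QOp.onBasis` below. -/
inductive QOp
  | const (d k : ℕ)
  | op (f : WordOp) (d a b : ℕ)
  | query (d a : ℕ)
  | realQuery (x a : ℕ)
  | realQueryInv (x a : ℕ)
  | rotate (r k x y : ℕ)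
  | signFlip (x : ℕ)

/-- Replace every numerical argument `t` of an instruction by `φ t`. -/
def QOp.rename (φ : ℕ → ℕ) : QOp → QOp
  | .const d k => .const (φ d) (φ k)
  | .op f d a b => .op f (φ d) (φ a) (φ b)
  | .query d a => .query (φ d) (φ a)
  | .realQuery x a => .realQuery (φ x) (φ a)
  | .realQueryInv x a => .realQueryInv (φ x) (φ a)
  | .rotate r k x y => .rotate (φ r) (φ k) (φ x) (φ y)
  | .signFlip x => .signFlip (φ x)

/-! ### The classical machine -/

/-- Programs of the classical machine. -/
inductive Cmd
  | skip
  | seq (p q : Cmd)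
  /-- word register `d` becomes the literal `k` -/
  | const (d k : ℕ)
  /-- word register `d` becomes `f` of the word registers `a`, `b` -/
  | op (f : WordOp) (d a b : ℕ)
  /-- word register `d` becomes the word cell whose address is in word register `a` -/
  | load (d a : ℕ)
  /-- the word cell whose address is in word register `a` becomes word register `s` -/
  | store (a s : ℕ)
  /-- real register `d` becomes `f` of the real registers `a`, `b` -/
  | realOp (f : RealOp) (d a b : ℕ)
  /-- real register `d` becomes the real cell whose address is in word register `a` -/
  | realLoad (d a : ℕ)
  /-- the real cell whose address is in word register `a` becomes real register `s` -/
  | realStore (a s : ℕ)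
  /-- word register `d` becomes `1` if real register `a` is less than real register `b`,
  and `0` otherwise -/
  | realLt (d a b : ℕ)
  /-- run `p` if word register `r` is not zero, and `q` otherwise -/
  | ite (r : ℕ) (p q : Cmd)
  /-- run `p` as many times as word register `r` says at the start -/
  | loop (r : ℕ) (p : Cmd)
  /-- issue the quantum instruction `g`, its arguments being read from the word registers that
  are named in `g` -/
  | emit (g : QOp)

/-- States of the classical machine: registers, memory, the quantum instructions issued so far,
and the number of instructions executed so far. -/
structure State (W : ℕ) where
  reg : ℕ → BitVec W
  realReg : ℕ → ℝ
  mem : Memory W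
  out : List QOp
  steps : ℕ

variable {W : ℕ}

def State.tick (s : State W) : State W := { s with steps := s.steps + 1 }

def State.setReg (s : State W) (d : ℕ) (v : BitVec W) : State W :=
  { s with reg := Function.update s.reg d v }

def State.setRealReg (s : State W) (d : ℕ) (v : ℝ) : State W :=
  { s with realReg := Function.update s.realReg d v }

/-- Every instruction, every branching and every round of a loop counts as one step. -/
def Cmd.run : Cmd → State W → State W
  | .skip, s => s.tick
  | .seq p q, s => q.run (p.run s)
  | .const d k, s => s.tick.setReg d (BitVec.ofNat W k)
  | .op f d a b, s => s.tick.setReg d (f.eval (s.reg a) (s.reg b))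
  | .load d a, s => s.tick.setReg d (s.mem.word (s.reg a))
  | .store a t, s =>
      { s.tick with
        mem := { s.mem with word := Function.update s.mem.word (s.reg a) (s.reg t) } }
  | .realOp f d a b, s => s.tick.setRealReg d (f.eval (s.realReg a) (s.realReg b))
  | .realLoad d a, s => s.tick.setRealReg d (s.mem.real (s.reg a))
  | .realStore a t, s =>
      { s.tick with
        mem := { s.mem with real := Function.update s.mem.real (s.reg a) (s.realReg t) } }
  | .realLt d a b, s =>
      open Classical in
      s.tick.setReg d (if s.realReg a < s.realReg b then 1#W else 0#W)
  | .ite r p q, s => if (s.reg r).toNat ≠ 0 then p.run s.tick else q.run s.tick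
  | .loop r p, s => (fun t : State W => p.run t.tick)^[(s.reg r).toNat] s.tick
  | .emit g, s => { s.tick with out := s.out ++ [g.rename fun t => (s.reg t).toNat] }

/-! ### The quantum machine -/

/-- A basis configuration of the quantum machine: the contents of its word registers (each made
of `W` qubits) and of its real registers. -/
@[ext]
structure Config (W : ℕ) where
  word : ℕ → BitVec W
  real : ℕ → ℝ

/-- Quantum states: finite superpositions of basis configurations, which form an orthonormal
family. -/
abbrev QState (W : ℕ) : Type := Config W →₀ ℂ

/-- The basis state of a configuration. -/
def ket (c : Config W) : QState W := Finsupp.single c 1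

def Config.setWord (c : Config W) (d : ℕ) (v : BitVec W) : Config W :=
  { c with word := Function.update c.word d v }

def Config.setReal (c : Config W) (x : ℕ) (v : ℝ) : Config W :=
  { c with real := Function.update c.real x v }

open Classical in
/-- The action of an instruction on a basis configuration, when the classical memory has
contents `M`.
* `const d k` and `op f d a b` are the reversible forms `|d⟩ ↦ |d ⊕ k⟩` and
  `|d⟩|a⟩|b⟩ ↦ |d ⊕ f(a,b)⟩|a⟩|b⟩` of word operations.
* `query` and `realQuery` are the quantum queries `|d⟩|a⟩ ↦ |d ⊕ M[a]⟩|a⟩` and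
  `|x⟩|a⟩ ↦ |x + M[a]⟩|a⟩` to the two parts of the memory; `realQueryInv` is the inverse of the
  latter.
* `rotate r k x y` acts on qubit `k` of word register `r`.  If the real registers `x`, `y` hold
  nonnegative numbers `X`, `Y` which are not both `0`, it is the rotation
  `|0⟩ ↦ (√X |0⟩ + √Y |1⟩)/√(X+Y)`, `|1⟩ ↦ (-√Y |0⟩ + √X |1⟩)/√(X+Y)`,
  and otherwise the identity.
* `signFlip x` multiplies by `-1` if the number in real register `x` is negative.

An operation whose target is one of its own arguments does nothing, so that every instruction
is unitary. -/
def QOp.onBasis (M : Memory W) (c : Config W) : QOp → QState W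
  | .const d k => ket (c.setWord d (c.word d ^^^ BitVec.ofNat W k))
  | .op f d a b =>
      if d = a ∨ d = b then ket c
      else ket (c.setWord d (c.word d ^^^ f.eval (c.word a) (c.word b)))
  | .query d a =>
      if d = a then ket c else ket (c.setWord d (c.word d ^^^ M.word (c.word a)))
  | .realQuery x a => ket (c.setReal x (c.real x + M.real (c.word a)))
  | .realQueryInv x a => ket (c.setReal x (c.real x - M.real (c.word a)))
  | .rotate r k x y =>
      let X := c.real x
      let Y := c.real y
      let flipped := c.setWord r (c.word r ^^^ BitVec.twoPow W k)
      let cosine : ℂ := (Real.sqrt (X / (X + Y)) : ℝ)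
      let sine : ℂ := (Real.sqrt (Y / (X + Y)) : ℝ)
      if k < W ∧ 0 ≤ X ∧ 0 ≤ Y ∧ 0 < X + Y then
        if (c.word r).getLsbD k then cosine • ket c - sine • ket flipped
        else cosine • ket c + sine • ket flipped
      else ket c
  | .signFlip x => if c.real x < 0 then -ket c else ket c

/-- The linear action of an instruction on quantum states. -/
def QOp.apply (M : Memory W) (g : QOp) : QState W →ₗ[ℂ] QState W :=
  Finsupp.linearCombination ℂ fun c => g.onBasis M c

/-- The action of a sequence of instructions, the head of the list being applied first. -/
def applyAll (M : Memory W) (gs : List QOp) (ψ : QState W) : QState W :=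
  gs.foldl (fun φ g => g.apply M φ) ψ

/-- The basis state `|a⟩|b⟩`: word register `0` holds `a`, word register `1` holds `b`, and all
other registers, the work space, hold `0`. -/
def ket₂ (W a b : ℕ) : QState W :=
  ket ⟨fun r => if r = 0 then BitVec.ofNat W a else if r = 1 then BitVec.ofNat W b else 0#W,
    fun _ => 0⟩

/-- The amplitudes `x k / ‖x‖` of the vector state `|x⟩` of a real vector `x`. -/
def amplitude {N : ℕ} (x : Fin N → ℝ) (k : Fin N) : ℂ := (x k / ‖WithLp.toLp 2 x‖ : ℝ)

/-- The vector of the Euclidean norms of the rows of a matrix. -/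
def rowNorms {m n : ℕ} (A : Matrix (Fin m) (Fin n) ℝ) : Fin m → ℝ :=
  fun i => ‖WithLp.toLp 2 (A i)‖

/-! ### Data structures -/

/-- An entry `(i, j, a)` that arrives in the system. -/
structure Entry (m n : ℕ) where
  row : Fin m
  col : Fin n
  val : ℝ

/-- The matrix currently stored after a sequence of arrivals: the value that arrived last at each
position, and `0` where nothing has arrived. -/
def currentMatrix {m n : ℕ} (es : List (Entry m n)) : Matrix (Fin m) (Fin n) ℝ :=
  Matrix.of fun i j => es.foldl (fun v e => if i = e.row ∧ j = e.col then e.val else v) 0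

/-- The number of entries that have arrived; an entry that arrives again is an update of the
stored value and is not counted again. -/
def arrivedCount {m n : ℕ} (es : List (Entry m n)) : ℕ :=
  (es.map fun e => (e.row, e.col)).toFinset.card

/-- A data structure with its algorithms: the program that stores a new entry, and the programs
that issue the instructions for the two quantum state preparations.  The programs are fixed and
do not depend on the dimensions.  Words have `wordFactor + 1` times the binary length
of `m * n` bits. -/
structure DataStructure where
  wordFactor : ℕ
  insert : Cmd
  prepareRow : Cmd
  prepareNorms : Cmd

namespace DataStructure

variable (D : DataStructure)

def wordSize (m n : ℕ) : ℕ := (D.wordFactor + 1) * (Nat.log 2 (m * n) + 1)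

/-- Run the insertion program on the entry `e` and memory `M`.  Word registers `0` to `4` hold the
row, the column, `m`, `n` and the word size, real register `0` holds the value, and all other
registers hold `0`. -/
def insertRun {m n : ℕ} (M : Memory (D.wordSize m n)) (e : Entry m n) :
    State (D.wordSize m n) :=
  D.insert.run
    { reg := fun r => BitVec.ofNat _
        (([e.row.val, e.col.val, m, n, D.wordSize m n] : List ℕ).getD r 0)
      realReg := fun r => if r = 0 then e.val else 0
      mem := M
      out := []
      steps := 0 }

/-- The contents of the memory after a sequence of arrivals, starting from the blank memory. -/
def memory {m n : ℕ} (es : List (Entry m n)) : Memory (D.wordSize m n) :=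
  es.foldl (fun M e => (D.insertRun M e).mem) (Memory.blank _)

/-- The time to store the entry `e` when the entries `es` have arrived before. -/
def insertTime {m n : ℕ} (es : List (Entry m n)) (e : Entry m n) : ℕ :=
  D.wordSize m n * (D.insertRun (D.memory es) e).steps

/-- Run a program that controls the quantum machine.  It is given `m`, `n` and the word size in
word registers `0` to `2`, and it has no access to the stored data. -/
def controlRun (p : Cmd) (m n : ℕ) : State (D.wordSize m n) :=
  p.run
    { reg := fun r => BitVec.ofNat _ (([m, n, D.wordSize m n] : List ℕ).getD r 0)
      realReg := fun _ => 0
      mem := Memory.blank _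
      out := []
      steps := 0 }

/-- The running time of a quantum algorithm: the steps of the controlling program together with
the instructions of the quantum machine. -/
def quantumTime (p : Cmd) (m n : ℕ) : ℕ :=
  D.wordSize m n * ((D.controlRun p m n).steps + (D.controlRun p m n).out.length)

/-- The effect on `ψ` of the quantum algorithm controlled by the program `p`, with quantum access to
the data structure after the arrivals `es`. -/
def quantumRun (p : Cmd) {m n : ℕ} (es : List (Entry m n)) (ψ : QState (D.wordSize m n)) :
    QState (D.wordSize m n) :=
  applyAll (D.memory es) (D.controlRun p m n).out ψ

end DataStructure

/-- `x` is a fixed-point number: an integer of at most `b` bits (and a sign) divided by `2 ^ s`. -/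
def IsFixedPoint (b s : ℕ) (x : ℝ) : Prop :=
  ∃ z : ℤ, |z| < 2 ^ b ∧ x = (z : ℝ) / 2 ^ s

end QDS

end

open QDS

namespace QDS

/-! Let `L` be the binary length of `m * n`. The entries are placed at the leaves of a complete
binary tree of depth `2 * L`: the path to the leaf of position `(i, j)` spells the `L` bits of `i`
and then the `L` bits of `j`. Every node has as its weight the sum of the squares of the entries
below it, so the node reached by the bits of `i` has weight ‖A_i‖², and the root has the sum of all
of these, the squared norm of the vector of row norms.

Only the root and the nodes on paths to positions that have arrived are stored, as records linked by
pointers. A position adds at most `2 * L` records of four words each, which gives the size bound.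
Replacing the value v of a leaf by a changes the weights of its ancestors and its own weight by the
same amount a² - v², so one walk that creates the missing nodes and a second walk that adds this
difference suffice (`insertProgram_run`, resting on `TreeInv` and `partialUpdate_depth`). Real
arithmetic is exact, so the stored sums are the true ones (`memory_spec`).

For the state preparation, a walk down keeps all pointers it has met. At a node of weight S = S₀ +
S₁ the next index bit, still 0, is rotated to √(S₀/S)|0⟩ + √(S₁/S)|1⟩, and then it selects the
child. The factors telescope: the amplitude of a descendant is the square root of its weight over
the weight of the starting node (`opsMap_superpose`). Starting from the node of row `i` this
produces |A_ij|/‖A_i‖, and a sign flip controlled by the signed value kept at the leaf gives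
A_ij/‖A_i‖ (`opsMap_rowOps`). Starting from the root and stopping at depth `L` it produces the
amplitudes of the row norms (`opsMap_normsOps`).

The pointers are functions of the memory and the final indices. The reversible step that computed a
pointer therefore erases it when repeated, in every branch of the superposition, and no garbage
stays entangled with the result. -/

section

/-! ### Sums of squares over the subtrees of a binary tree -/

/-- The sum of the squares of the values `V` at the descendants, `d` levels below, of the node with
heap index `h`; the children of `h` are `2 * h` and `2 * h + 1`. -/
noncomputable def subtreeSum (V : ℕ → ℝ) : ℕ → ℕ → ℝ
  | 0, h => V h ^ 2
  | d + 1, h => subtreeSum V d (2 * h) + subtreeSum V d (2 * h + 1)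

theorem subtreeSum_nonneg (V : ℕ → ℝ) (d h : ℕ) : 0 ≤ subtreeSum V d h := by
  induction d generalizing h with
  | zero => exact sq_nonneg _
  | succ d ih => exact add_nonneg (ih _) (ih _)

theorem subtreeSum_zero (d h : ℕ) : subtreeSum (fun _ => 0) d h = 0 := by
  induction d generalizing h with
  | zero => simp [subtreeSum]
  | succ d ih => simp [subtreeSum, ih]

/-- The leaf `l` is a descendant of `h` exactly when dropping its last `d` bits leaves `h`; then one
square in the sum is exchanged. -/
theorem subtreeSum_update (V : ℕ → ℝ) (l : ℕ) (a : ℝ) (d h : ℕ) :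
    subtreeSum (Function.update V l a) d h =
      subtreeSum V d h + if l / 2 ^ d = h then a ^ 2 - V l ^ 2 else 0 := by
  induction d generalizing h with
  | zero =>
    rcases eq_or_ne l h with rfl | hl
    · simp [subtreeSum]
    · simp [subtreeSum, hl, Function.update_of_ne hl.symm]
  | succ d ih =>
    simp only [subtreeSum, ih]
    have e : l / 2 ^ (d + 1) = l / 2 ^ d / 2 := by rw [pow_succ, Nat.div_div_eq_div_mul]
    rw [e]
    generalize l / 2 ^ d = q
    by_cases h1 : q = 2 * h
    · rw [if_pos h1, if_neg (by omega), if_pos (by omega)]; ring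
    · by_cases h2 : q = 2 * h + 1
      · rw [if_neg h1, if_pos h2, if_pos (by omega)]; ring
      · rw [if_neg h1, if_neg h2, if_neg (by omega)]; ring

theorem sum_range_two_mul {M : Type*} [AddCommMonoid M] (f : ℕ → M) (N : ℕ) :
    ∑ q ∈ Finset.range (2 * N), f q = ∑ q ∈ Finset.range N, (f (2 * q) + f (2 * q + 1)) := by
  induction N with
  | zero => simp
  | succ N ih =>
    rw [show 2 * (N + 1) = 2 * N + 1 + 1 by ring, Finset.sum_range_succ, Finset.sum_range_succ, ih,
      Finset.sum_range_succ, add_assoc]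

/-- With `e = 0` this turns the weight of a row node into a sum over columns; with `e = d` it splits
the weight of the root over the rows. -/
theorem subtreeSum_add (V : ℕ → ℝ) (d e h : ℕ) :
    subtreeSum V (e + d) h = ∑ q ∈ Finset.range (2 ^ d), subtreeSum V e (h * 2 ^ d + q) := by
  induction d generalizing e with
  | zero => simp
  | succ d ih =>
    rw [show e + (d + 1) = (e + 1) + d by ring, ih, pow_succ', sum_range_two_mul]
    refine Finset.sum_congr rfl fun q _ => ?_
    rw [subtreeSum, show 2 * (h * 2 ^ d + q) = h * (2 * 2 ^ d) + 2 * q by ring, add_assoc]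

/-- Squaring doubles both the bit length and the scale; each level adds two numbers of equal scale
and so costs one more bit. -/
theorem subtreeSum_fixedPoint {V : ℕ → ℝ} {b s : ℕ} (hV : ∀ h, IsFixedPoint b s (V h)) (d h : ℕ) :
    IsFixedPoint (2 * b + d) (2 * s) (subtreeSum V d h) := by
  induction d generalizing h with
  | zero =>
    obtain ⟨z, hz, e⟩ := hV h
    refine ⟨z ^ 2, ?_, ?_⟩
    · rw [abs_pow, add_zero, pow_mul']
      exact pow_lt_pow_left₀ hz (abs_nonneg _) two_ne_zero
    · rw [subtreeSum, e, div_pow, ← pow_mul, mul_comm s]; push_cast; rfl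
  | succ d ih =>
    obtain ⟨z, hz, e⟩ := ih (2 * h)
    obtain ⟨z', hz', e'⟩ := ih (2 * h + 1)
    refine ⟨z + z', ?_, ?_⟩
    · refine (abs_add_le _ _).trans_lt ?_
      rw [← add_assoc, pow_succ]; linarith
    · rw [subtreeSum, e, e']; push_cast; ring

/-- The numbers stored in the tree of depth `T` with leaf values `V`: subtree sums at all nodes,
and the value of the leaf `l` at the position `2 * l` below it. -/
noncomputable def cellValue (T : ℕ) (V : ℕ → ℝ) (h : ℕ) : ℝ :=
  if h < 2 ^ (T + 1) then subtreeSum V (T - Nat.log 2 h) h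
  else if h % 2 = 0 ∧ h / 2 < 2 ^ (T + 1) then V (h / 2) else 0

theorem log_eq_of_mem {t h : ℕ} (h1 : 2 ^ t ≤ h) (h2 : h < 2 ^ (t + 1)) : Nat.log 2 h = t := by
  have : h ≠ 0 := by have := Nat.two_pow_pos t; omega
  exact (Nat.log_eq_iff (Or.inr ⟨by norm_num, this⟩)).2 ⟨h1, h2⟩

theorem cellValue_node {T : ℕ} (V : ℕ → ℝ) {d h : ℕ} (hd : d ≤ T) (h1 : 2 ^ d ≤ h)
    (h2 : h < 2 ^ (d + 1)) : cellValue T V h = subtreeSum V (T - d) h := by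
  rw [cellValue, if_pos (h2.trans_le (Nat.pow_le_pow_right (by norm_num) (by omega))),
    log_eq_of_mem h1 h2]

theorem cellValue_leaf {T : ℕ} (V : ℕ → ℝ) {l : ℕ} (h1 : 2 ^ T ≤ l) (h2 : l < 2 ^ (T + 1)) :
    cellValue T V (2 * l) = V l := by
  rw [cellValue, if_neg (by rw [pow_succ]; omega), if_pos (by omega)]
  congr 1; omega

theorem cellValue_zero (T h : ℕ) : cellValue T (fun _ => 0) h = 0 := by
  simp [cellValue, subtreeSum_zero]

theorem cellValue_fixedPoint {V : ℕ → ℝ} {b s : ℕ} (hV : ∀ h, IsFixedPoint b s (V h)) (T h : ℕ) :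
    ∃ s', s' ≤ 2 * s ∧ IsFixedPoint (2 * b + T) s' (cellValue T V h) := by
  have mono : ∀ {b b' s : ℕ} {x : ℝ}, b ≤ b' → IsFixedPoint b s x → IsFixedPoint b' s x := by
    rintro b b' s x hb ⟨z, hz, e⟩
    exact ⟨z, hz.trans_le (pow_le_pow_right₀ (by norm_num) hb), e⟩
  unfold cellValue
  split_ifs
  · exact ⟨2 * s, le_rfl, mono (by omega) (subtreeSum_fixedPoint hV _ _)⟩
  · exact ⟨s, by omega, mono (by omega) (hV _)⟩
  · exact ⟨s, by omega, 0, by positivity, by simp⟩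

/-- The stored numbers after the value of the leaf `l` has been replaced by `a`, and the sums have
been corrected at the ancestors of `l` in the levels `1` to `d`. -/
noncomputable def partialUpdate (T : ℕ) (V : ℕ → ℝ) (l : ℕ) (a : ℝ) : ℕ → ℕ → ℝ
  | 0 => Function.update (cellValue T V) (2 * l) a
  | d + 1 =>
    let F := partialUpdate T V l a d
    Function.update F (l / 2 ^ (T - (d + 1))) (F (l / 2 ^ (T - (d + 1))) + (a ^ 2 - V l ^ 2))

theorem log_ancestor {T l d : ℕ} (h1 : 2 ^ T ≤ l) (h2 : l < 2 ^ (T + 1)) (hd : d ≤ T) :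
    Nat.log 2 (l / 2 ^ (T - d)) = d := by
  rw [Nat.log_div_base_pow, log_eq_of_mem h1 h2]; omega

/-- The level of an ancestor of `l` can be read off its heap index as `Nat.log 2 h`, so each
ancestor is corrected in exactly one round. The condition `1 < h` excludes the root, which no round
reaches. -/
theorem partialUpdate_eq {T l : ℕ} (V : ℕ → ℝ) (a : ℝ) (h1 : 2 ^ T ≤ l) (h2 : l < 2 ^ (T + 1))
    {d : ℕ} (hd : d ≤ T) (h : ℕ) : partialUpdate T V l a d h =
      if h = 2 * l then a else cellValue T V h +
        if 1 < h ∧ Nat.log 2 h ≤ d ∧ l / 2 ^ (T - Nat.log 2 h) = h then a ^ 2 - V l ^ 2 else 0 := by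
  have hl : 1 ≤ l := le_trans Nat.one_le_two_pow h1
  induction d generalizing h with
  | zero =>
    rw [partialUpdate]
    split_ifs with e1 e2
    · rw [e1, Function.update_self]
    · have := Nat.log_pos (b := 2) (by norm_num) (show 2 ≤ h by omega)
      omega
    · rw [Function.update_of_ne e1, add_zero]
  | succ d ih =>
    have hlog := log_ancestor h1 h2 hd
    have hle : l / 2 ^ (T - (d + 1)) ≤ l := Nat.div_le_self _ _
    have hgt : 1 < l / 2 ^ (T - (d + 1)) := by
      by_contra hc
      have : Nat.log 2 (l / 2 ^ (T - (d + 1))) ≤ Nat.log 2 1 := Nat.log_mono_right (by omega)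
      rw [hlog, Nat.log_one_right] at this; omega
    simp only [partialUpdate]
    rcases eq_or_ne h (l / 2 ^ (T - (d + 1))) with e | e
    · rw [e, Function.update_self, ih (by omega), if_neg (by omega), if_neg (by omega), hlog,
        if_neg (by omega), if_pos ⟨hgt, by omega, rfl⟩]
      ring
    · rw [Function.update_of_ne e, ih (by omega)]
      congr 2
      refine if_congr ?_ rfl rfl
      constructor
      · rintro ⟨a1, a2, a3⟩; exact ⟨a1, by omega, a3⟩
      · rintro ⟨a1, a2, a3⟩
        refine ⟨a1, ?_, a3⟩
        by_contra hc
        have : Nat.log 2 h = d + 1 := by omega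
        rw [this] at a3; exact e a3.symm

/-- After all `T` rounds, the corrected positions are those whose subtree contains `l`, as in
`subtreeSum_update`. Index `1` is left out because the total weight has no cell: a node stores the
weights of its children, not its own. -/
theorem partialUpdate_depth {T l : ℕ} (V : ℕ → ℝ) (a : ℝ) (h1 : 2 ^ T ≤ l) (h2 : l < 2 ^ (T + 1))
    {h : ℕ} (hh : 1 < h) :
    partialUpdate T V l a T h = cellValue T (Function.update V l a) h := by
  rw [partialUpdate_eq V a h1 h2 le_rfl]
  split_ifs with e1 e2
  · rw [e1, cellValue_leaf _ h1 h2, Function.update_self]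
  · obtain ⟨a1, a2, a3⟩ := e2
    have : h < 2 ^ (T + 1) := lt_of_le_of_lt (a3 ▸ Nat.div_le_self _ _) h2
    rw [cellValue, cellValue, if_pos this, if_pos this, subtreeSum_update, if_pos a3]
  · rw [add_zero, cellValue, cellValue]
    split_ifs with e3 e4
    · rw [subtreeSum_update, if_neg, add_zero]
      intro a3
      exact e2 ⟨hh, Nat.lt_succ_iff.1 (Nat.log_lt_of_lt_pow (by omega) e3), a3⟩
    · rw [Function.update_of_ne (by omega)]
    · rfl

/-! ### The tree in memory -/

theorem ofNat_inj {W x y : ℕ} (hx : x < 2 ^ W) (hy : y < 2 ^ W) :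
    BitVec.ofNat W x = BitVec.ofNat W y ↔ x = y := by
  refine ⟨fun h => ?_, fun h => h ▸ rfl⟩
  have := congrArg BitVec.toNat h
  rwa [BitVec.toNat_ofNat, BitVec.toNat_ofNat, Nat.mod_eq_of_lt hx, Nat.mod_eq_of_lt hy] at this

theorem update_ofNat {W : ℕ} {α : Type*} (f : BitVec W → α) {x y : ℕ} (v : α) (hx : x < 2 ^ W)
    (hy : y < 2 ^ W) :
    Function.update f (BitVec.ofNat W x) v (BitVec.ofNat W y) =
      if y = x then v else f (BitVec.ofNat W y) := by
  simp only [Function.update_apply, ofNat_inj hy hx]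

/-- The memory `M` holds a tree with `k` nodes besides its root.  The node with heap index `h` is
stored at the address `N h`, and `N h = 0` if it is not stored.  The word cell `N h + b` holds the
address of the child `2 * h + b`, and the real cell `N h + b` holds the number `F (2 * h + b)`. -/
structure TreeInv {W : ℕ} (M : Memory W) (N : ℕ → ℕ) (k : ℕ) (F : ℕ → ℝ) : Prop where
  bound : 4 + 2 * k ≤ 2 ^ W
  root : N 1 = 2
  zero : N 0 = 0
  le : ∀ h, N h ≠ 0 → N h + 2 ≤ 4 + 2 * k
  even : ∀ h, N h % 2 = 0
  inj : ∀ h h', N h ≠ 0 → N h = N h' → h = h'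
  parent : ∀ h b, 1 ≤ h → b < 2 → N (2 * h + b) ≠ 0 → N h ≠ 0
  counter : M.word (BitVec.ofNat W 0) = BitVec.ofNat W (2 * k)
  child : ∀ h b, N h ≠ 0 → b < 2 → M.word (BitVec.ofNat W (N h + b)) = BitVec.ofNat W (N (2 * h + b))
  wordBlank : ∀ x, 4 + 2 * k ≤ x → x < 2 ^ W → M.word (BitVec.ofNat W x) = BitVec.ofNat W 0
  cell : ∀ h b, N h ≠ 0 → b < 2 → M.real (BitVec.ofNat W (N h + b)) = F (2 * h + b)
  cellZero : ∀ h b, 1 ≤ h → N h = 0 → b < 2 → F (2 * h + b) = 0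
  realBlank : ∀ x, x < 2 ^ W → M.real (BitVec.ofNat W x) ≠ 0 → ∃ h b, N h ≠ 0 ∧ b < 2 ∧ x = N h + b

theorem treeInv_blank {W : ℕ} (hW : 4 ≤ 2 ^ W) :
    TreeInv (Memory.blank W) (Function.update 0 1 2) 0 (fun _ => 0) where
  bound := by omega
  root := by simp
  zero := by simp
  le h hh := by
    have : h = 1 := by by_contra hc; simp [hc] at hh
    simp [this]
  even h := by rw [Function.update_apply]; split_ifs <;> simp
  inj h h' hh e := by
    have : h = 1 := by by_contra hc; simp [hc] at hh
    by_contra hc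
    have h1 : h' ≠ 1 := by omega
    simp [h1, this] at e
  parent h b h1 hb hh := by
    have : 2 * h + b ≠ 1 := by omega
    simp [this] at hh
  counter := rfl
  child h b hh hb := by
    have : h = 1 := by by_contra hc; simp [hc] at hh
    have : 2 * h + b ≠ 1 := by omega
    simp [this, Memory.blank]
  wordBlank _ _ _ := rfl
  cell _ _ _ _ := rfl
  cellZero _ _ _ _ _ := rfl
  realBlank _ _ h := absurd rfl h

variable {W : ℕ} {M : Memory W} {N : ℕ → ℕ} {k : ℕ} {F : ℕ → ℝ}

theorem TreeInv.addr_lt (I : TreeInv M N k F) {h b : ℕ} (hh : N h ≠ 0) (hb : b < 2) :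
    N h + b < 2 ^ W := by
  have := I.le h hh; have := I.bound; omega

theorem TreeInv.two_le (I : TreeInv M N k F) {h : ℕ} (hh : N h ≠ 0) : 2 ≤ N h := by
  have := I.even h; omega

/-- Node addresses are even, so the address of a cell determines both the node and the choice of
child. -/
theorem TreeInv.addr_inj (I : TreeInv M N k F) {h h' b b' : ℕ} (hh : N h ≠ 0)
    (hb : b < 2) (hb' : b' < 2) : N h + b = N h' + b' ↔ 2 * h + b = 2 * h' + b' := by
  constructor
  · intro e
    have := I.even h; have := I.even h'
    have e' : N h = N h' := by omega
    have := I.inj h h' hh e'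
    omega
  · intro e
    have e1 : h = h' := by omega
    have e2 : b = b' := by omega
    rw [e1, e2]

theorem TreeInv.index_pos (I : TreeInv M N k F) {h : ℕ} (hh : N h ≠ 0) : 1 ≤ h := by
  rcases Nat.eq_zero_or_pos h with rfl | h0
  · exact absurd I.zero hh
  · exact h0

theorem TreeInv.congr (I : TreeInv M N k F) {F' : ℕ → ℝ} (hF : ∀ h, 1 < h → F h = F' h) :
    TreeInv M N k F' where
  __ := I
  cell h b hh hb := by rw [I.cell h b hh hb, hF]; have := I.index_pos hh; omega
  cellZero h b h1 hh hb := by rw [← hF _ (by omega), I.cellZero h b h1 hh hb]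

/-- Storing a number in a cell of the tree. -/
theorem TreeInv.setCell (I : TreeInv M N k F) {h b : ℕ} (hh : N h ≠ 0) (hb : b < 2) (v : ℝ) :
    TreeInv { M with real := Function.update M.real (BitVec.ofNat W (N h + b)) v } N k
      (Function.update F (2 * h + b) v) where
  bound := I.bound
  root := I.root
  zero := I.zero
  le := I.le
  even := I.even
  inj := I.inj
  parent := I.parent
  counter := I.counter
  child := I.child
  wordBlank := I.wordBlank
  cell h' b' hh' hb' := by
    dsimp only
    rw [update_ofNat _ _ (I.addr_lt hh hb) (I.addr_lt hh' hb'), Function.update_apply,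
      I.cell h' b' hh' hb']
    exact if_congr (I.addr_inj hh' hb' hb) rfl rfl
  cellZero h' b' h1 hh' hb' := by
    rw [Function.update_of_ne, I.cellZero h' b' h1 hh' hb']
    intro e
    have : h' = h := by omega
    exact hh (this ▸ hh')
  realBlank x hx hv := by
    dsimp only at hv
    rw [update_ofNat _ _ (I.addr_lt hh hb) hx] at hv
    split_ifs at hv with e
    · exact ⟨h, b, hh, hb, e⟩
    · exact I.realBlank x hx hv

/-- Creating a new node. -/
theorem TreeInv.alloc (I : TreeInv M N k F) {h b : ℕ} (hh : N h ≠ 0) (hb : b < 2)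
    (hc : N (2 * h + b) = 0) (hk : 4 + 2 * (k + 1) ≤ 2 ^ W) :
    TreeInv { M with word := Function.update (Function.update M.word (BitVec.ofNat W 0)
        (BitVec.ofNat W (2 * k + 2))) (BitVec.ofNat W (N h + b)) (BitVec.ofNat W (4 + 2 * k)) }
      (Function.update N (2 * h + b) (4 + 2 * k)) (k + 1) F := by
  have h1 := I.index_pos hh
  have key : ∀ h', Function.update N (2 * h + b) (4 + 2 * k) h' ≠ 0 →
      h' = 2 * h + b ∨ h' ≠ 2 * h + b ∧ N h' ≠ 0 := by
    intro h' hh'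
    rw [Function.update_apply] at hh'
    split_ifs at hh' with e
    · exact Or.inl e
    · exact Or.inr ⟨e, hh'⟩
  refine ⟨hk, ?_, ?_, ?_, ?_, ?_, ?_, ?_, ?_, ?_, ?_, ?_, ?_⟩
  · rw [Function.update_of_ne (by omega), I.root]
  · rw [Function.update_of_ne (by omega), I.zero]
  · intro h' hh'
    rcases key h' hh' with rfl | ⟨e, hn⟩
    · rw [Function.update_self]; omega
    · rw [Function.update_of_ne e]; have := I.le h' hn; omega
  · intro h'
    rw [Function.update_apply]
    split_ifs
    · omega
    · exact I.even h'
  · intro h' h'' hh' e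
    simp only [Function.update_apply] at e hh'
    split_ifs at e hh' with e1 e2 e2
    · omega
    · have := I.le h'' (by omega); omega
    · have := I.le h' (by omega); omega
    · exact I.inj h' h'' hh' e
  · intro h' b' h1' hb' hn
    rcases key _ hn with e | ⟨e, hn'⟩
    · have : h' = h := by omega
      rw [this, Function.update_of_ne (by omega)]; exact hh
    · have := I.parent h' b' h1' hb' hn'
      rw [Function.update_apply]; split_ifs <;> omega
  · dsimp only
    have := I.two_le hh
    rw [update_ofNat _ _ (I.addr_lt hh hb) (by omega), if_neg (by omega), Function.update_self]
    rfl
  · intro h' b' hn hb'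
    dsimp only
    rcases key _ hn with e | ⟨e, hn'⟩
    · subst e
      rw [Function.update_self,
        Function.update_of_ne (show 2 * (2 * h + b) + b' ≠ 2 * h + b by omega)]
      have := I.le h hh
      rw [update_ofNat _ _ (I.addr_lt hh hb) (by omega), if_neg (by omega),
        update_ofNat _ _ (by omega) (by omega), if_neg (by omega),
        I.wordBlank _ (by omega) (by omega)]
      -- Stored nodes have stored parents, so a node that was missing has no stored children, and
      -- the blank word cells of its record are already correct null pointers.
      have : N (2 * (2 * h + b) + b') = 0 := by
        by_contra hc'
        exact I.parent _ _ (by omega) hb' hc' hc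
      rw [this]
    · have := I.two_le hn'
      have := I.addr_lt hn' hb'
      rw [Function.update_of_ne e, update_ofNat _ _ (I.addr_lt hh hb) this,
        update_ofNat _ _ (by omega) this, if_neg (show ¬ N h' + b' = 0 by omega),
        I.child h' b' hn' hb', Function.update_apply]
      simp only [I.addr_inj hn' hb' hb]
      split_ifs <;> rfl
  · intro x hx hx'
    dsimp only
    have := I.le h hh
    rw [update_ofNat _ _ (I.addr_lt hh hb) hx', if_neg (by omega),
      update_ofNat _ _ (by omega) hx', if_neg (by omega), I.wordBlank x (by omega) hx']
  · intro h' b' hn hb'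
    dsimp only
    rcases key _ hn with e | ⟨e, hn'⟩
    · subst e
      -- The numbers below a missing node are `0`, and the new record lies beyond all cells in use,
      -- where the real memory is blank.
      rw [Function.update_self, I.cellZero _ b' (by omega) hc hb']
      by_contra hv
      obtain ⟨h'', b'', q1, q2, q3⟩ := I.realBlank _ (by omega) hv
      have := I.le h'' q1
      omega
    · rw [Function.update_of_ne e, I.cell h' b' hn' hb']
  · intro h' b' h1' hn hb'
    rw [Function.update_apply] at hn
    split_ifs at hn with e
    · omega
    · exact I.cellZero h' b' h1' hn hb'
  · intro x hx hv
    obtain ⟨h'', b'', q1, q2, q3⟩ := I.realBlank _ hx hv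
    refine ⟨h'', b'', ?_, q2, ?_⟩ <;> rw [Function.update_of_ne]
    · exact q1
    · intro e; exact q1 (e ▸ hc)
    · exact q3
    · intro e; exact q1 (e ▸ hc)

theorem TreeInv.size_le (I : TreeInv M N k F) : M.size ≤ (2 * (4 + 2 * k)) * W := by
  have h1 : M.wordCells ≤ 4 + 2 * k := Nat.sInf_le fun a ha => by
    have := I.wordBlank a.toNat ha a.isLt
    rwa [BitVec.ofNat_toNat, BitVec.setWidth_eq] at this
  have h2 : M.realCells ≤ 4 + 2 * k := Nat.sInf_le fun a ha => by
    by_contra hc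
    have h := I.realBlank a.toNat a.isLt
    rw [BitVec.ofNat_toNat, BitVec.setWidth_eq] at h
    obtain ⟨h', b, q1, q2, q3⟩ := h hc
    have := I.le h' q1
    omega
  exact Nat.mul_le_mul_right _ (by omega)

theorem TreeInv.real_eq (I : TreeInv M N k F) (a : BitVec W) :
    M.real a = 0 ∨ ∃ h, M.real a = F h := by
  by_contra! hc
  have h := I.realBlank a.toNat a.isLt
  rw [BitVec.ofNat_toNat, BitVec.setWidth_eq] at h
  obtain ⟨h', b, q1, q2, q3⟩ := h hc.1
  have := I.cell h' b q1 q2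
  rw [← q3, BitVec.ofNat_toNat, BitVec.setWidth_eq] at this
  exact hc.2 _ this

end

/-! ### Loops and the arithmetic of machine words -/

section

variable {W : ℕ}

/-- Run commands one after the other. -/
def Cmd.block : List Cmd → Cmd
  | [] => .skip
  | p :: ps => .seq p (Cmd.block ps)

/-- The ticks are part of the statement because the loop instruction and each of its rounds are
charged one step, and the invariants bound the step count. -/
theorem run_loop_invariant (P : ℕ → State W → Prop) {r : ℕ} {p : Cmd} {s : State W} {n : ℕ}
    (hr : s.reg r = BitVec.ofNat W n) (hn : n < 2 ^ W) (h0 : P 0 s.tick)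
    (hs : ∀ d < n, ∀ t, P d t → P (d + 1) (p.run t.tick)) : P n ((Cmd.loop r p).run s) := by
  have hr' : (s.reg r).toNat = n := by rw [hr, BitVec.toNat_ofNat, Nat.mod_eq_of_lt hn]
  rw [Cmd.run, hr']
  have : ∀ d ≤ n, P d ((fun t : State W => p.run t.tick)^[d] s.tick) := by
    intro d
    induction d with
    | zero => exact fun _ => h0
    | succ d ih =>
      intro hd
      rw [Function.iterate_succ_apply']
      exact hs d (by omega) _ (ih (by omega))
  exact this n le_rfl

theorem shr_ofNat {x t : ℕ} (hx : x < 2 ^ W) (ht : t < 2 ^ W) :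
    BitVec.ofNat W x >>> (BitVec.ofNat W t).toNat = BitVec.ofNat W (x / 2 ^ t) := by
  apply BitVec.eq_of_toNat_eq
  rw [BitVec.toNat_ushiftRight, BitVec.toNat_ofNat, BitVec.toNat_ofNat, BitVec.toNat_ofNat,
    Nat.mod_eq_of_lt hx, Nat.mod_eq_of_lt ht, Nat.shiftRight_eq_div_pow, Nat.mod_eq_of_lt]
  exact (Nat.div_le_self _ _).trans_lt hx

theorem shl_ofNat {x t : ℕ} (hx : x < 2 ^ W) (ht : t < 2 ^ W) :
    BitVec.ofNat W x <<< (BitVec.ofNat W t).toNat = BitVec.ofNat W (x * 2 ^ t) := by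
  apply BitVec.eq_of_toNat_eq
  rw [BitVec.toNat_shiftLeft, BitVec.toNat_ofNat, BitVec.toNat_ofNat, BitVec.toNat_ofNat,
    Nat.mod_eq_of_lt hx, Nat.mod_eq_of_lt ht, Nat.shiftLeft_eq]

theorem and_one_ofNat (hW : 0 < W) (x : ℕ) :
    BitVec.ofNat W x &&& BitVec.ofNat W 1 = BitVec.ofNat W (x % 2) := by
  apply BitVec.eq_of_toNat_eq
  have : 1 < 2 ^ W := Nat.one_lt_two_pow (by omega)
  rw [BitVec.toNat_and, BitVec.toNat_ofNat, BitVec.toNat_ofNat, BitVec.toNat_ofNat,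
    Nat.mod_eq_of_lt this, Nat.and_one_is_mod,
    Nat.mod_mod_of_dvd _ (dvd_pow_self 2 (by omega)), Nat.mod_eq_of_lt (a := x % 2) (by omega)]

theorem bit_ofNat (hW : 0 < W) {x t : ℕ} (hx : x < 2 ^ W) (ht : t < 2 ^ W) :
    BitVec.ofNat W x >>> (BitVec.ofNat W t).toNat &&& BitVec.ofNat W 1 =
      BitVec.ofNat W (x / 2 ^ t % 2) := by
  rw [shr_ofNat hx ht, and_one_ofNat hW]

theorem div_pow_step (l t : ℕ) : 2 * (l / 2 ^ (t + 1)) + l / 2 ^ t % 2 = l / 2 ^ t := by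
  rw [pow_succ, ← Nat.div_div_eq_div_mul]
  omega

/-! ### The insertion program -/

/-- One step down the tree: with the leaf index in register `7` and the address of the current node
in register `10`, decrease the level in register `9` and put the address of the cell that belongs
to the next node on the path into register `16`. -/
def nextCell : List Cmd :=
  [.op .sub 9 9 11, .op .shr 15 7 9, .op .and 15 15 11, .op .add 16 10 15]

/-- A pointer `0` means that the child is missing. Register `13` holds `0`, the address of the
counter `2 * k`; adding the `4` of register `5` to the counter gives the first free address. -/
def descend : Cmd :=
  .block (nextCell ++ [.load 10 16, .ite 10 .skip (.block
    [.load 17 13, .op .add 10 5 17, .op .add 17 17 14, .store 13 17, .store 16 10])])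

def addAlongPath : Cmd :=
  .block (nextCell ++ [.realLoad 2 16, .realOp .add 2 2 1, .realStore 16 2, .load 10 16])

/-- The `4` in register `5` serves twice: as the shift that turns the word size `16 * L` into `L`,
and later as the offset of the first record after the root. The root has address `2`. -/
def insertInit : Cmd :=
  .block
    [.const 5 4, .op .shr 6 4 5, .const 11 1, .const 14 2, .const 10 2,
     .op .shl 7 11 6, .op .add 7 7 0, .op .shl 7 7 6, .op .add 7 7 1,
     .op .add 8 6 6, .op .add 9 6 6]

def storeLeaf : Cmd :=
  .block
    [.realLoad 1 10, .realOp .mul 1 1 1, .realOp .mul 2 0 0, .realOp .sub 1 2 1, .realStore 10 0,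
     .const 10 2, .op .add 9 6 6]

/-- Store the number in real register `0` at the row and column in word registers `0` and `1`. -/
def insertProgram : Cmd :=
  .seq insertInit (.seq (.loop 8 descend) (.seq storeLeaf (.loop 8 addAlongPath)))

/-- The registers that stay fixed in both loops. -/
structure InsertRegs (L l : ℕ) (a : ℝ) (s : State W) : Prop where
  r5 : s.reg 5 = BitVec.ofNat W 4
  r6 : s.reg 6 = BitVec.ofNat W L
  r7 : s.reg 7 = BitVec.ofNat W l
  r8 : s.reg 8 = BitVec.ofNat W (2 * L)
  r11 : s.reg 11 = BitVec.ofNat W 1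
  r13 : s.reg 13 = BitVec.ofNat W 0
  r14 : s.reg 14 = BitVec.ofNat W 2
  a0 : s.realReg 0 = a

/-- The invariant of the first loop. -/
structure DescendInv (L l : ℕ) (a : ℝ) (N₀ : ℕ → ℕ) (k₀ : ℕ) (F : ℕ → ℝ) (σ d : ℕ)
    (s : State W) : Prop extends InsertRegs L l a s where
  r9 : s.reg 9 = BitVec.ofNat W (2 * L - d)
  steps : s.steps ≤ σ + 20 * d
  tree : ∃ N k, TreeInv s.mem N k F ∧ k ≤ k₀ + d ∧ (N₀ l ≠ 0 → k = k₀) ∧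
    (∀ h, N₀ h ≠ 0 → N h ≠ 0) ∧ N (l / 2 ^ (2 * L - d)) ≠ 0 ∧
    s.reg 10 = BitVec.ofNat W (N (l / 2 ^ (2 * L - d)))

/-- The invariant of the second loop. -/
structure AddInv (L l : ℕ) (a δ : ℝ) (N : ℕ → ℕ) (k : ℕ) (F : ℕ → ℕ → ℝ) (σ d : ℕ)
    (s : State W) : Prop extends InsertRegs L l a s where
  r9 : s.reg 9 = BitVec.ofNat W (2 * L - d)
  a1 : s.realReg 1 = δ
  steps : s.steps ≤ σ + 20 * d
  tree : TreeInv s.mem N k (F d)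
  r10 : s.reg 10 = BitVec.ofNat W (N (l / 2 ^ (2 * L - d)))

theorem TreeInv.ancestor {M : Memory W} {N k F} (I : TreeInv M N k F) {l t : ℕ}
    (hl : N l ≠ 0) (ht : 1 ≤ l / 2 ^ t) : N (l / 2 ^ t) ≠ 0 := by
  induction t with
  | zero => simpa using hl
  | succ t ih =>
    have e := div_pow_step l t
    exact I.parent _ (l / 2 ^ t % 2) ht (Nat.mod_lt _ two_pos) (by rw [e]; exact ih (by omega))

theorem TreeInv.word_eq_zero_iff {M : Memory W} {N k F} (I : TreeInv M N k F) (h : ℕ) :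
    (BitVec.ofNat W (N h)).toNat = 0 ↔ N h = 0 := by
  rw [BitVec.toNat_ofNat, Nat.mod_eq_of_lt]
  by_cases hh : N h = 0
  · rw [hh]; exact Nat.two_pow_pos W
  · exact I.addr_lt (b := 0) hh (by norm_num)

theorem one_le_div_pow {T l t : ℕ} (hl : 2 ^ T ≤ l) (ht : t ≤ T) : 1 ≤ l / 2 ^ t :=
  (Nat.one_le_div_iff (Nat.two_pow_pos t)).2 ((Nat.pow_le_pow_right two_pos ht).trans hl)

theorem descend_step {L l : ℕ} {a : ℝ} {N₀ : ℕ → ℕ} {k₀ : ℕ} {F : ℕ → ℝ} {σ d : ℕ}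
    (hW : 0 < W) (hLW : 2 * L < 2 ^ W) (hlW : l < 2 ^ W)
    (hk : 4 + 2 * (k₀ + 2 * L) ≤ 2 ^ W) (hd : d < 2 * L)
    (hN : ∀ t ≤ 2 * L, N₀ l ≠ 0 → N₀ (l / 2 ^ t) ≠ 0)
    (t : State W) (ht : DescendInv L l a N₀ k₀ F σ d t) :
    DescendInv L l a N₀ k₀ F σ (d + 1) (descend.run t.tick) := by
  obtain ⟨N, k, I, hk1, hk2, hNN, hn, h10⟩ := ht.tree
  obtain ⟨⟨r5, r6, r7, r8, r11, r13, r14, a0⟩, r9, hst, -⟩ := ht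
  have e9 : BitVec.ofNat W (2 * L - d) - BitVec.ofNat W 1 = BitVec.ofNat W (2 * L - (d + 1)) := by
    rw [BitVec.ofNat_sub_ofNat_of_le _ _ (Nat.one_lt_two_pow (by omega)) (by omega), Nat.sub_sub]
  have eb := bit_ofNat hW hlW (t := 2 * L - (d + 1)) (by omega)
  have eh := div_pow_step l (2 * L - (d + 1))
  rw [show 2 * L - (d + 1) + 1 = 2 * L - d by omega] at eh
  have hb : l / 2 ^ (2 * L - (d + 1)) % 2 < 2 := Nat.mod_lt _ two_pos
  obtain ⟨h, hh⟩ : ∃ h, l / 2 ^ (2 * L - d) = h := ⟨_, rfl⟩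
  obtain ⟨b, hb'⟩ : ∃ b, l / 2 ^ (2 * L - (d + 1)) % 2 = b := ⟨_, rfl⟩
  rw [hh] at eh hn h10
  rw [hb'] at eb hb eh
  have ec := I.child h b hn hb
  have ea : BitVec.ofNat W (N h) + BitVec.ofNat W b = BitVec.ofNat W (N h + b) :=
    (BitVec.ofNat_add _ _).symm
  by_cases hc : N (2 * h + b) = 0
  · have hz := (I.word_eq_zero_iff (2 * h + b)).2 hc
    -- Had the leaf been stored at the start, its whole path would have been stored too. Hence no
    -- node is created when a stored entry is overwritten, and `k` then keeps its initial value.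
    have h0 : N₀ l = 0 := by
      by_contra h0
      exact hNN _ (hN (2 * L - (d + 1)) (by omega) h0) (eh ▸ hc)
    have ek := I.counter
    have e4 : BitVec.ofNat W 4 + BitVec.ofNat W (2 * k) = BitVec.ofNat W (4 + 2 * k) :=
      (BitVec.ofNat_add _ _).symm
    have e2 : BitVec.ofNat W (2 * k) + BitVec.ofNat W 2 = BitVec.ofNat W (2 * k + 2) :=
      (BitVec.ofNat_add _ _).symm
    have J := I.alloc hn hb hc (by omega)
    have run : (descend.run t.tick).mem = { t.mem with
        word := Function.update (Function.update t.mem.word (BitVec.ofNat W 0)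
          (BitVec.ofNat W (2 * k + 2))) (BitVec.ofNat W (N h + b)) (BitVec.ofNat W (4 + 2 * k)) } ∧
        (descend.run t.tick).reg 9 = BitVec.ofNat W (2 * L - (d + 1)) ∧
        (descend.run t.tick).reg 10 = BitVec.ofNat W (4 + 2 * k) ∧
        (descend.run t.tick).steps = t.steps + 14 ∧ InsertRegs L l a (descend.run t.tick) := by
      refine ⟨?_, ?_, ?_, ?_, ?_, ?_, ?_, ?_, ?_, ?_, ?_, ?_⟩ <;>
        simp [descend, nextCell, Cmd.block, Cmd.run, State.tick, State.setReg,
          WordOp.eval, -BitVec.toNat_ofNat, r5, r6, r7, r8, r11, r13, r14, a0, r9, h10, e9, eb, ea,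
          ec, hz, ek, e4, e2]
    obtain ⟨m1, m2, m3, m4, m5⟩ := run
    refine ⟨m5, m2, by omega, Function.update N (2 * h + b) (4 + 2 * k), k + 1, m1 ▸ J, by omega,
      fun h0' => absurd h0 h0', fun h' hh' => ?_, ?_, ?_⟩
    · rw [Function.update_apply]
      split_ifs
      · omega
      · exact hNN h' hh'
    · rw [← eh, Function.update_self]; omega
    · rw [← eh, Function.update_self, m3]
  · have hz := mt (I.word_eq_zero_iff (2 * h + b)).1 hc
    have run : (descend.run t.tick).mem = t.mem ∧
        (descend.run t.tick).reg 9 = BitVec.ofNat W (2 * L - (d + 1)) ∧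
        (descend.run t.tick).reg 10 = BitVec.ofNat W (N (2 * h + b)) ∧
        (descend.run t.tick).steps = t.steps + 9 ∧ InsertRegs L l a (descend.run t.tick) := by
      refine ⟨?_, ?_, ?_, ?_, ?_, ?_, ?_, ?_, ?_, ?_, ?_, ?_⟩ <;>
        simp [descend, nextCell, Cmd.block, Cmd.run, State.tick, State.setReg,
          WordOp.eval, -BitVec.toNat_ofNat, r5, r6, r7, r8, r11, r13, r14, a0, r9, h10, e9, eb, ea,
          ec, hz]
    obtain ⟨m1, m2, m3, m4, m5⟩ := run
    exact ⟨m5, m2, by omega, N, k, m1 ▸ I, by omega, hk2, hNN, eh ▸ hc, eh ▸ m3⟩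

/-- The cell visited in this round is the one for the ancestor of `l` at level `d + 1`, so adding
the difference there is one step of the recursion of `partialUpdate`. -/
theorem addAlongPath_step {L l : ℕ} {a : ℝ} {V : ℕ → ℝ} {N : ℕ → ℕ} {k : ℕ} {σ d : ℕ}
    (hW : 0 < W) (hLW : 2 * L < 2 ^ W) (hl : 2 ^ (2 * L) ≤ l) (hlW : l < 2 ^ W)
    (hd : d < 2 * L) (hN : N l ≠ 0) (t : State W)
    (ht : AddInv L l a (a ^ 2 - V l ^ 2) N k (partialUpdate (2 * L) V l a) σ d t) :
    AddInv L l a (a ^ 2 - V l ^ 2) N k (partialUpdate (2 * L) V l a) σ (d + 1)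
      (addAlongPath.run t.tick) := by
  obtain ⟨⟨r5, r6, r7, r8, r11, r13, r14, a0⟩, r9, a1, hst, I, h10⟩ := ht
  have hn : N (l / 2 ^ (2 * L - d)) ≠ 0 := I.ancestor hN (one_le_div_pow hl (by omega))
  have e9 : BitVec.ofNat W (2 * L - d) - BitVec.ofNat W 1 = BitVec.ofNat W (2 * L - (d + 1)) := by
    rw [BitVec.ofNat_sub_ofNat_of_le _ _ (Nat.one_lt_two_pow (by omega)) (by omega), Nat.sub_sub]
  have eb := bit_ofNat hW hlW (t := 2 * L - (d + 1)) (by omega)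
  have eh := div_pow_step l (2 * L - (d + 1))
  rw [show 2 * L - (d + 1) + 1 = 2 * L - d by omega] at eh
  have hb : l / 2 ^ (2 * L - (d + 1)) % 2 < 2 := Nat.mod_lt _ two_pos
  obtain ⟨h, hh⟩ : ∃ h, l / 2 ^ (2 * L - d) = h := ⟨_, rfl⟩
  obtain ⟨b, hb'⟩ : ∃ b, l / 2 ^ (2 * L - (d + 1)) % 2 = b := ⟨_, rfl⟩
  rw [hh] at eh hn h10
  rw [hb'] at eb hb eh
  have ec := I.child h b hn hb
  have er := I.cell h b hn hb
  have ea : BitVec.ofNat W (N h) + BitVec.ofNat W b = BitVec.ofNat W (N h + b) :=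
    (BitVec.ofNat_add _ _).symm
  have J := I.setCell hn hb
    (partialUpdate (2 * L) V l a d (2 * h + b) + (a ^ 2 - V l ^ 2))
  have run : (addAlongPath.run t.tick).mem = { t.mem with
      real := Function.update t.mem.real (BitVec.ofNat W (N h + b))
        (partialUpdate (2 * L) V l a d (2 * h + b) + (a ^ 2 - V l ^ 2)) } ∧
      (addAlongPath.run t.tick).reg 9 = BitVec.ofNat W (2 * L - (d + 1)) ∧
      (addAlongPath.run t.tick).reg 10 = BitVec.ofNat W (N (2 * h + b)) ∧
      (addAlongPath.run t.tick).realReg 1 = a ^ 2 - V l ^ 2 ∧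
      (addAlongPath.run t.tick).steps = t.steps + 10 ∧
      InsertRegs L l a (addAlongPath.run t.tick) := by
    refine ⟨?_, ?_, ?_, ?_, ?_, ?_, ?_, ?_, ?_, ?_, ?_, ?_, ?_⟩ <;>
      simp [addAlongPath, nextCell, Cmd.block, Cmd.run, State.tick, State.setReg, State.setRealReg,
        WordOp.eval, RealOp.eval, -BitVec.toNat_ofNat, r5, r6, r7, r8, r11, r13, r14, a0, a1, r9,
        h10, e9, eb, ea, ec, er]
  obtain ⟨m1, m2, m3, m4, m5, m6⟩ := run
  refine ⟨m6, m2, m4, by omega, ?_, eh ▸ m3⟩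
  rw [m1]
  simp only [partialUpdate, ← eh]
  exact J

/-- The leaf of the tree at which the entry in row `i` and column `j` is stored. -/
def leafIndex (L i j : ℕ) : ℕ := (2 ^ L + i) * 2 ^ L + j

theorem le_leafIndex (L i j : ℕ) : 2 ^ (2 * L) ≤ leafIndex L i j := by
  rw [leafIndex, two_mul, pow_add]; nlinarith [Nat.zero_le (i * 2 ^ L)]

theorem leafIndex_lt {L i j : ℕ} (hi : i < 2 ^ L) (hj : j < 2 ^ L) :
    leafIndex L i j < 2 ^ (2 * L + 1) := by
  rw [leafIndex, pow_succ, two_mul, pow_add]; nlinarith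

theorem div_depth {T l : ℕ} (hl : 2 ^ T ≤ l) (hl2 : l < 2 ^ (T + 1)) : l / 2 ^ (T - 0) = 1 := by
  rw [Nat.sub_zero, Nat.div_eq_iff (Nat.two_pow_pos _)]
  rw [pow_succ] at hl2; omega

theorem insertInit_run {L i j : ℕ} {a : ℝ} (hL : 2 ≤ L) (hWL : W = 16 * L) (hi : i < 2 ^ L)
    {s : State W} (r0 : s.reg 0 = BitVec.ofNat W i)
    (r1 : s.reg 1 = BitVec.ofNat W j) (r4 : s.reg 4 = BitVec.ofNat W W)
    (r13 : s.reg 13 = BitVec.ofNat W 0) (a0 : s.realReg 0 = a) :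
    (insertInit.run s).tick.mem = s.mem ∧
      (insertInit.run s).tick.reg 9 = BitVec.ofNat W (2 * L) ∧
      (insertInit.run s).tick.reg 10 = BitVec.ofNat W 2 ∧
      (insertInit.run s).tick.steps = s.steps + 13 ∧
      InsertRegs L (leafIndex L i j) a (insertInit.run s).tick := by
  have hW : 0 < W := by omega
  have hWp : W < 2 ^ W := Nat.lt_two_pow_self
  have hLW : 2 * L < 2 ^ W := by omega
  have hLp : 1 < 2 ^ L := Nat.one_lt_two_pow (by omega)
  have hL2 : 2 ^ L < 2 ^ W := Nat.pow_lt_pow_right (by norm_num) (by omega)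
  have hLi : 2 ^ L + i < 2 ^ W := by
    have : 2 ^ (L + 1) ≤ 2 ^ W := Nat.pow_le_pow_right (by norm_num) (by omega)
    rw [pow_succ] at this; omega
  -- Words have `16 * L` bits, so the depth parameter is the word size shifted by four places.
  have e1 : BitVec.ofNat W W >>> (BitVec.ofNat W 4).toNat = BitVec.ofNat W L := by
    rw [shr_ofNat hWp (by omega)]; congr 1; omega
  have e2 : BitVec.ofNat W 1 <<< (BitVec.ofNat W L).toNat = BitVec.ofNat W (2 ^ L) := by
    rw [shl_ofNat (by omega) (by omega), one_mul]
  have e3 : BitVec.ofNat W (2 ^ L) + BitVec.ofNat W i = BitVec.ofNat W (2 ^ L + i) :=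
    (BitVec.ofNat_add _ _).symm
  have e4 : BitVec.ofNat W (2 ^ L + i) <<< (BitVec.ofNat W L).toNat =
      BitVec.ofNat W ((2 ^ L + i) * 2 ^ L) := shl_ofNat hLi (by omega)
  have e5 : BitVec.ofNat W ((2 ^ L + i) * 2 ^ L) + BitVec.ofNat W j =
      BitVec.ofNat W (leafIndex L i j) := (BitVec.ofNat_add _ _).symm
  have e6 : BitVec.ofNat W L + BitVec.ofNat W L = BitVec.ofNat W (2 * L) := by
    rw [← BitVec.ofNat_add, two_mul]
  generalize leafIndex L i j = l at *
  generalize (2 ^ L + i) * 2 ^ L = z at *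
  generalize 2 ^ L + i = y at *
  generalize 2 ^ L = x at *
  refine ⟨?_, ?_, ?_, ?_, ?_, ?_, ?_, ?_, ?_, ?_, ?_, ?_⟩ <;>
    simp [insertInit, Cmd.block, Cmd.run, State.tick, State.setReg,
      WordOp.eval, -BitVec.toNat_ofNat, r0, r1, r4, r13, a0, e1, e2, e3, e4, e5, e6]

theorem storeLeaf_run {L l : ℕ} {a v : ℝ} {x : BitVec W} {u : State W} (r : InsertRegs L l a u)
    (h10 : u.reg 10 = x) (er : u.mem.real x = v) :
    (storeLeaf.run u).tick.mem = { u.mem with real := Function.update u.mem.real x a } ∧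
      (storeLeaf.run u).tick.reg 9 = BitVec.ofNat W (2 * L) ∧
      (storeLeaf.run u).tick.reg 10 = BitVec.ofNat W 2 ∧
      (storeLeaf.run u).tick.realReg 1 = a ^ 2 - v ^ 2 ∧
      (storeLeaf.run u).tick.steps = u.steps + 9 ∧
      InsertRegs L l a (storeLeaf.run u).tick := by
  obtain ⟨r5, r6, r7, r8, r11, r13, r14, a0⟩ := r
  have e6 : BitVec.ofNat W L + BitVec.ofNat W L = BitVec.ofNat W (2 * L) := by
    rw [← BitVec.ofNat_add, two_mul]
  refine ⟨?_, ?_, ?_, ?_, ?_, ?_, ?_, ?_, ?_, ?_, ?_, ?_, ?_⟩ <;>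
    simp [storeLeaf, Cmd.block, Cmd.run, State.tick, State.setReg, State.setRealReg,
      WordOp.eval, RealOp.eval, -BitVec.toNat_ofNat, r5, r6, r7, r8, r11, r13, r14, a0,
      h10, e6, er, pow_two]

/-- Two walks are needed because the difference of the squares is known only once the leaf has been
reached. The straight-line parts cost `13 + 9 = 22` steps, and each walk has `2 * L` rounds of at
most `20` steps. -/
theorem insertProgram_run {L i j : ℕ} {a : ℝ} (hL : 2 ≤ L) (hWL : W = 16 * L) (hi : i < 2 ^ L)
    (hj : j < 2 ^ L) {s : State W} (r0 : s.reg 0 = BitVec.ofNat W i)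
    (r1 : s.reg 1 = BitVec.ofNat W j) (r4 : s.reg 4 = BitVec.ofNat W W)
    (r13 : s.reg 13 = BitVec.ofNat W 0) (a0 : s.realReg 0 = a) {N₀ : ℕ → ℕ} {k₀ : ℕ} {V : ℕ → ℝ}
    (I₀ : TreeInv s.mem N₀ k₀ (cellValue (2 * L) V)) (hk : 4 + 2 * (k₀ + 2 * L) ≤ 2 ^ W) :
    (insertProgram.run s).steps ≤ s.steps + 22 + 80 * L ∧
    ∃ N k, TreeInv (insertProgram.run s).mem N k
      (cellValue (2 * L) (Function.update V (leafIndex L i j) a)) ∧ k ≤ k₀ + 2 * L ∧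
      (N₀ (leafIndex L i j) ≠ 0 → k = k₀) ∧ (∀ h, N₀ h ≠ 0 → N h ≠ 0) ∧
      N (leafIndex L i j) ≠ 0 := by
  have hW : 0 < W := by omega
  have hLW : 2 * L < 2 ^ W := by
    have : W < 2 ^ W := Nat.lt_two_pow_self
    omega
  have hl := le_leafIndex L i j
  have hl2 := leafIndex_lt hi hj
  have hlW : leafIndex L i j < 2 ^ W := hl2.trans (Nat.pow_lt_pow_right (by norm_num) (by omega))
  have m := insertInit_run (j := j) hL hWL hi r0 r1 r4 r13 a0
  generalize leafIndex L i j = l at *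
  have init : DescendInv L l a N₀ k₀ (cellValue (2 * L) V) (s.steps + 13) 0
      (insertInit.run s).tick := by
    obtain ⟨m1, m2, m3, m4, m5⟩ := m
    have h1 := div_depth hl hl2
    refine ⟨m5, m2, m4.le, N₀, k₀, m1 ▸ I₀, by omega, fun _ => rfl, fun _ => id, ?_, ?_⟩
    · rw [h1, I₀.root]; norm_num
    · rw [h1, I₀.root, m3]
  have anc : ∀ t ≤ 2 * L, N₀ l ≠ 0 → N₀ (l / 2 ^ t) ≠ 0 := fun t ht hn =>
    I₀.ancestor hn (one_le_div_pow hl ht)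
  have mid := run_loop_invariant (DescendInv L l a N₀ k₀ (cellValue (2 * L) V) (s.steps + 13))
    (s := insertInit.run s) (r := 8) init.r8 hLW init
    (fun d hd t ht => descend_step hW hLW hlW hk hd anc t ht)
  -- After the first walk register `10` holds the address of the leaf, whose first real cell still
  -- contains the old value.
  rw [insertProgram, Cmd.run, Cmd.run, Cmd.run]
  generalize (Cmd.loop 8 descend).run (insertInit.run s) = u at mid
  obtain ⟨N, k, I, hk1, hk2, hNN, hn, h10⟩ := mid.tree
  have hst := mid.steps
  rw [Nat.sub_self, pow_zero, Nat.div_one] at hn h10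
  have leaf : AddInv L l a (a ^ 2 - V l ^ 2) N k (partialUpdate (2 * L) V l a)
      (s.steps + 22 + 40 * L) 0 (storeLeaf.run u).tick := by
    have er := I.cell l 0 hn two_pos
    rw [add_zero, add_zero, cellValue_leaf V hl hl2] at er
    obtain ⟨m1, m2, m3, m4, m5, m6⟩ := storeLeaf_run mid.toInsertRegs h10 er
    have h1 := div_depth hl hl2
    refine ⟨m6, m2, m4, by omega, ?_, ?_⟩
    · have J := I.setCell hn two_pos a
      rw [add_zero, add_zero] at J
      rw [m1, partialUpdate]
      exact J
    · rw [h1, I.root, m3]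
  have fin := run_loop_invariant (AddInv L l a (a ^ 2 - V l ^ 2) N k
    (partialUpdate (2 * L) V l a) (s.steps + 22 + 40 * L)) (s := storeLeaf.run u) (r := 8)
    leaf.r8 hLW leaf (fun d hd t ht => addAlongPath_step hW hLW hl hlW hd hn t ht)
  refine ⟨by have := fin.steps; omega, N, k, ?_, hk1, hk2, hNN, hn⟩
  exact fin.tree.congr fun h hh => partialUpdate_depth V a hl hl2 hh

end

section

variable {W : ℕ}

/-! ### The programs that control the quantum machine -/

/-- With the address of a node in register `p`, put the address of its child that is selected by
bit `t` of register `r` into register `p + 1`.  Applied again, this is undone. -/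
def stepOps (r t p : ℕ) : List QOp :=
  [.const 3 t, .op .shr 4 r 3, .op .and 5 4 2, .op .add 6 p 5, .query (p + 1) 6,
   .op .add 6 p 5, .op .and 5 4 2, .op .shr 4 r 3, .const 3 t]

/-- Rotate bit `t` of register `r` as told by the two numbers at the node with address in `p`. -/
def rotOps (r t p : ℕ) : List QOp :=
  [.op .add 6 p 2, .realQuery 0 p, .realQuery 1 6, .rotate r t 0 1, .realQueryInv 1 6,
   .realQueryInv 0 p, .op .add 6 p 2]

/-- Multiply by the sign of the first number at the node with address in register `p`. -/
def signOps (p : ℕ) : List QOp := [.realQuery 0 p, .signFlip 0, .realQueryInv 0 p]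

/-- One level of the walk down the tree, with or without a rotation. -/
def levelOps (rot : Bool) (r t p : ℕ) : List QOp :=
  (if rot then rotOps r t p else []) ++ stepOps r t p

/-- The first `d` of `L` levels of a walk down, guided by register `r`. -/
def walkOps (rot : Bool) (r L p d : ℕ) : List QOp :=
  (List.range d).flatMap fun k => levelOps rot r (L - 1 - k) (p + k)

/-- Undo the last `d` levels of a walk down that ended at register `p`. -/
def unwalkOps (r p d : ℕ) : List QOp :=
  (List.range d).flatMap fun k => stepOps r k (p - 1 - k)

/-- Quantum register `2` holds the constant `1`, registers `3` to `6` are scratch, and register `8 +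
d` receives the pointer to the node at depth `d`. The weights determine only absolute values, so the
sign is read at the leaf before the pointers are erased. -/
def rowOps (L : ℕ) : List QOp :=
  [.const 2 1, .const 8 2] ++ walkOps false 0 L 8 L ++ walkOps true 1 L (8 + L) L ++
    signOps (8 + L + L) ++ unwalkOps 1 (8 + L + L) L ++ unwalkOps 0 (8 + L) L ++
    [.const 8 2, .const 2 1]

def normsOps (L : ℕ) : List QOp :=
  [.const 2 1, .const 8 2] ++ walkOps true 0 L 8 L ++ unwalkOps 0 (8 + L) L ++
    [.const 8 2, .const 2 1]

/-- Arguments of issued instructions are taken from control registers: register `10 + x` holds the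
name `x` for `x ≤ 6`, and registers `4`, `5`, `6` hold the current bit `t` and the pointer names
`p`, `p + 1`. -/
def emitStep (r : ℕ) : List Cmd :=
  [.emit (.const 13 4), .emit (.op .shr 14 r 13), .emit (.op .and 15 14 12),
   .emit (.op .add 16 5 15), .emit (.query 6 16), .emit (.op .add 16 5 15),
   .emit (.op .and 15 14 12), .emit (.op .shr 14 r 13), .emit (.const 13 4)]

def emitRot (r : ℕ) : List Cmd :=
  [.emit (.op .add 16 5 12), .emit (.realQuery 10 5), .emit (.realQuery 11 16),
   .emit (.rotate r 4 10 11), .emit (.realQueryInv 11 16), .emit (.realQueryInv 10 5),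
   .emit (.op .add 16 5 12)]

def emitSign : Cmd :=
  .block [.emit (.realQuery 10 5), .emit (.signFlip 10), .emit (.realQueryInv 10 5)]

def levelDown (rot : Bool) (r : ℕ) : Cmd :=
  .block (.op .sub 4 4 11 :: (if rot then emitRot r else []) ++ emitStep r ++
    [.op .add 5 5 11, .op .add 6 6 11])

def levelUp (r : ℕ) : Cmd :=
  .block ([.op .sub 5 5 11, .op .sub 6 6 11] ++ emitStep r ++ [.op .add 4 4 11])

def controlInit : Cmd :=
  .block [.const 7 4, .op .shr 3 2 7, .const 10 0, .const 11 1, .const 12 2, .const 13 3,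
    .const 14 4, .const 15 5, .const 16 6, .const 5 8, .const 6 9, .emit (.const 12 11),
    .emit (.const 5 12)]

def controlDone : Cmd := .block [.emit (.const 5 12), .emit (.const 12 11)]

/-- Register `10` holds `0`, so the addition copies the number of levels: bits are visited from the
most significant one down. The walk up starts at bit `0` instead. -/
def walkDown (rot : Bool) (r : ℕ) : Cmd :=
  .seq (.op .add 4 3 10) (.loop 3 (levelDown rot r))

def walkUp (r : ℕ) : Cmd :=
  .seq (.const 4 0) (.loop 3 (levelUp r))

def rowProgram : Cmd :=
  .seq controlInit (.seq (walkDown false 10) (.seq (walkDown true 11) (.seq emitSign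
    (.seq (walkUp 11) (.seq (walkUp 10) controlDone)))))

def normsProgram : Cmd :=
  .seq controlInit (.seq (walkDown true 10) (.seq (walkUp 10) controlDone))

structure ControlInv (L t p : ℕ) (ops : List QOp) (σ : ℕ) (s : State W) : Prop where
  r3 : s.reg 3 = BitVec.ofNat W L
  r4 : s.reg 4 = BitVec.ofNat W t
  r5 : s.reg 5 = BitVec.ofNat W p
  r6 : s.reg 6 = BitVec.ofNat W (p + 1)
  r10 : s.reg 10 = BitVec.ofNat W 0
  r11 : s.reg 11 = BitVec.ofNat W 1
  r12 : s.reg 12 = BitVec.ofNat W 2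
  r13 : s.reg 13 = BitVec.ofNat W 3
  r14 : s.reg 14 = BitVec.ofNat W 4
  r15 : s.reg 15 = BitVec.ofNat W 5
  r16 : s.reg 16 = BitVec.ofNat W 6
  out : s.out = ops
  steps : s.steps ≤ σ

theorem toNat_ofNat_of_lt {x : ℕ} (hx : x < 2 ^ W) : (BitVec.ofNat W x).toNat = x := by
  rw [BitVec.toNat_ofNat, Nat.mod_eq_of_lt hx]

theorem literals_toNat (hW : 16 ≤ W) : (BitVec.ofNat W 0).toNat = 0 ∧
    (BitVec.ofNat W 1).toNat = 1 ∧ (BitVec.ofNat W 2).toNat = 2 ∧ (BitVec.ofNat W 3).toNat = 3 ∧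
    (BitVec.ofNat W 4).toNat = 4 ∧ (BitVec.ofNat W 5).toNat = 5 ∧ (BitVec.ofNat W 6).toNat = 6 ∧
    (BitVec.ofNat W 8).toNat = 8 := by
  have big : 2 ^ 16 ≤ 2 ^ W := Nat.pow_le_pow_right (by norm_num) hW
  refine ⟨?_, ?_, ?_, ?_, ?_, ?_, ?_, ?_⟩ <;> exact toNat_ofNat_of_lt (by omega)

theorem levelDown_run {L t p σ : ℕ} {ops : List QOp} (rot : Bool) {r : ℕ} (hr : r < 2)
    (hW : 16 ≤ W) (ht : t < 2 ^ W) (hp : p + 1 < 2 ^ W) {s : State W}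
    (h : ControlInv L (t + 1) p ops σ s) :
    ControlInv L t (p + 1) (ops ++ levelOps rot r t p) (σ + 30)
      ((levelDown rot (10 + r)).run s.tick) := by
  obtain ⟨r3, r4, r5, r6, r10, r11, r12, r13, r14, r15, r16, ho, hs⟩ := h
  obtain ⟨q0, q1, q2, q3, q4, q5, q6, -⟩ := literals_toNat hW
  have qt := toNat_ofNat_of_lt ht
  have qp := toNat_ofNat_of_lt (W := W) (x := p) (by omega)
  have qp' := toNat_ofNat_of_lt hp
  rw [BitVec.ofNat_add] at qp' r4 r6
  obtain rfl | rfl : r = 0 ∨ r = 1 := by omega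
  all_goals
    cases rot
    all_goals
      refine ⟨?_, ?_, ?_, ?_, ?_, ?_, ?_, ?_, ?_, ?_, ?_, ?_, ?_⟩
      all_goals
        simp [levelDown, emitStep, emitRot, Cmd.block, Cmd.run, State.tick, State.setReg,
          QOp.rename, WordOp.eval, levelOps, stepOps, rotOps, BitVec.ofNat_add,
          -BitVec.toNat_ofNat, -BitVec.toNat_add, r3, r4, r5, r6, r10, r11, r12, r13, r14, r15,
          r16, ho, q0, q1, q2, q3, q4, q5, q6, qt, qp, qp']
      any_goals omega

theorem levelUp_run {L t p σ : ℕ} {ops : List QOp} {r : ℕ} (hr : r < 2)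
    (hW : 16 ≤ W) (ht : t < 2 ^ W) (hp : p + 1 < 2 ^ W) {s : State W}
    (h : ControlInv L t (p + 1) ops σ s) :
    ControlInv L (t + 1) p (ops ++ stepOps r t p) (σ + 30) ((levelUp (10 + r)).run s.tick) := by
  obtain ⟨r3, r4, r5, r6, r10, r11, r12, r13, r14, r15, r16, ho, hs⟩ := h
  obtain ⟨q0, q1, q2, q3, q4, q5, q6, -⟩ := literals_toNat hW
  have qt := toNat_ofNat_of_lt ht
  have qp := toNat_ofNat_of_lt (W := W) (x := p) (by omega)
  have qp' := toNat_ofNat_of_lt hp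
  rw [BitVec.ofNat_add] at qp' r5
  rw [BitVec.ofNat_add, BitVec.ofNat_add] at r6
  obtain rfl | rfl : r = 0 ∨ r = 1 := by omega
  all_goals
    refine ⟨?_, ?_, ?_, ?_, ?_, ?_, ?_, ?_, ?_, ?_, ?_, ?_, ?_⟩
    all_goals
      simp [levelUp, emitStep, Cmd.block, Cmd.run, State.tick, State.setReg,
        QOp.rename, WordOp.eval, stepOps, BitVec.ofNat_add,
        -BitVec.toNat_ofNat, -BitVec.toNat_add, r3, r4, r5, r6, r10, r11, r12, r13, r14, r15,
        r16, ho, q0, q1, q2, q3, q4, q5, q6, qt, qp, qp']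
    any_goals omega

theorem walkDown_run {L t p σ : ℕ} {ops : List QOp} (rot : Bool) {r : ℕ} (hr : r < 2)
    (hW : 16 ≤ W) (hp : p + L < 2 ^ W) {s : State W} (h : ControlInv L t p ops σ s) :
    ControlInv L 0 (p + L) (ops ++ walkOps rot r L p L) (σ + 30 * L + 2)
      ((walkDown rot (10 + r)).run s) := by
  have hL : ControlInv L L p ops (σ + 2) ((Cmd.op .add 4 3 10).run s).tick := by
    obtain ⟨r3, r4, r5, r6, r10, r11, r12, r13, r14, r15, r16, ho, hs⟩ := h
    refine ⟨?_, ?_, ?_, ?_, ?_, ?_, ?_, ?_, ?_, ?_, ?_, ?_, ?_⟩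
    all_goals
      simp [Cmd.run, State.tick, State.setReg, WordOp.eval, *]
  have := run_loop_invariant (fun d => ControlInv L (L - d) (p + d)
    (ops ++ walkOps rot r L p d) (σ + 2 + 30 * d)) (s := (Cmd.op .add 4 3 10).run s) (r := 3)
    (p := levelDown rot (10 + r)) (n := L)
    hL.r3 (by omega) (by simpa [walkOps] using hL) (fun d hd u hu => by
      have e : L - d = (L - 1 - d) + 1 := by omega
      rw [e] at hu
      have := levelDown_run rot hr hW (by omega) (by omega) hu
      rw [List.append_assoc, add_assoc] at this
      rw [walkOps, List.range_succ, List.flatMap_append, List.flatMap_singleton,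
        show L - (d + 1) = L - 1 - d by omega]
      exact this)
  rw [Nat.sub_self, show σ + 2 + 30 * L = σ + 30 * L + 2 by ring] at this
  exact this

theorem walkUp_run {L t p σ : ℕ} {ops : List QOp} {r : ℕ} (hr : r < 2)
    (hW : 16 ≤ W) (hp : p + L < 2 ^ W) {s : State W} (h : ControlInv L t (p + L) ops σ s) :
    ControlInv L L p (ops ++ unwalkOps r (p + L) L) (σ + 30 * L + 2)
      ((walkUp (10 + r)).run s) := by
  have hL : ControlInv L 0 (p + L) ops (σ + 2) ((Cmd.const 4 0).run s).tick := by
    obtain ⟨r3, r4, r5, r6, r10, r11, r12, r13, r14, r15, r16, ho, hs⟩ := h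
    refine ⟨?_, ?_, ?_, ?_, ?_, ?_, ?_, ?_, ?_, ?_, ?_, ?_, ?_⟩
    all_goals
      simp [Cmd.run, State.tick, State.setReg, *]
  have := run_loop_invariant (fun d => ControlInv L d (p + (L - d))
    (ops ++ unwalkOps r (p + L) d) (σ + 2 + 30 * d)) (s := (Cmd.const 4 0).run s) (r := 3)
    (p := levelUp (10 + r)) (n := L)
    hL.r3 (by omega) (by simpa [unwalkOps] using hL) (fun d hd u hu => by
      have e : p + (L - d) = (p + L - 1 - d) + 1 := by omega
      rw [e] at hu
      have := levelUp_run hr hW (by omega) (by omega) hu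
      rw [List.append_assoc, add_assoc] at this
      rw [unwalkOps, List.range_succ, List.flatMap_append, List.flatMap_singleton,
        show p + (L - (d + 1)) = p + L - 1 - d by omega]
      exact this)
  rw [Nat.sub_self, show σ + 2 + 30 * L = σ + 30 * L + 2 by ring] at this
  exact this

theorem controlInit_run {L : ℕ} (hL : 1 ≤ L) (hWL : W = 16 * L) {s : State W}
    (r2 : s.reg 2 = BitVec.ofNat W W) (r4 : s.reg 4 = BitVec.ofNat W 0) (ho : s.out = []) :
    ControlInv L 0 8 [.const 2 1, .const 8 2] (s.steps + 14) (controlInit.run s) := by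
  have hW : 16 ≤ W := by omega
  have hWp : W < 2 ^ W := Nat.lt_two_pow_self
  obtain ⟨q0, q1, q2, q3, q4, q5, q6, q8⟩ := literals_toNat hW
  have e1 : BitVec.ofNat W W >>> (BitVec.ofNat W 4).toNat = BitVec.ofNat W L := by
    rw [shr_ofNat hWp (by omega)]; congr 1; omega
  rw [q4] at e1
  refine ⟨?_, ?_, ?_, ?_, ?_, ?_, ?_, ?_, ?_, ?_, ?_, ?_, ?_⟩
  all_goals
    simp [controlInit, Cmd.block, Cmd.run, State.tick, State.setReg, QOp.rename, WordOp.eval,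
      -BitVec.toNat_ofNat, r2, r4, ho, q1, q2, q4, q8, e1]

theorem controlDone_run {L t σ : ℕ} {ops : List QOp} (hW : 16 ≤ W) {s : State W}
    (h : ControlInv L t 8 ops σ s) : (controlDone.run s).out = ops ++ [.const 8 2, .const 2 1] ∧
      (controlDone.run s).steps ≤ σ + 3 := by
  obtain ⟨q0, q1, q2, q3, q4, q5, q6, q8⟩ := literals_toNat hW
  have hs := h.steps
  constructor <;>
    simp [controlDone, Cmd.block, Cmd.run, State.tick, QOp.rename, -BitVec.toNat_ofNat, h.r5,
      h.r11, h.r12, h.out, q1, q2, q8]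
  omega

theorem emitSign_run {L t p σ : ℕ} {ops : List QOp} (hW : 16 ≤ W) (hp : p < 2 ^ W) {s : State W}
    (h : ControlInv L t p ops σ s) :
    ControlInv L t p (ops ++ signOps p) (σ + 4) (emitSign.run s) := by
  obtain ⟨r3, r4, r5, r6, r10, r11, r12, r13, r14, r15, r16, ho, hs⟩ := h
  have q0 : (BitVec.ofNat W 0).toNat = 0 := (literals_toNat hW).1
  have qp := toNat_ofNat_of_lt hp
  refine ⟨?_, ?_, ?_, ?_, ?_, ?_, ?_, ?_, ?_, ?_, ?_, ?_, ?_⟩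
  all_goals
    simp [emitSign, signOps, Cmd.block, Cmd.run, State.tick, QOp.rename, -BitVec.toNat_ofNat, *]

theorem rowProgram_run {L : ℕ} (hL : 1 ≤ L) (hWL : W = 16 * L) {s : State W}
    (r2 : s.reg 2 = BitVec.ofNat W W) (r4 : s.reg 4 = BitVec.ofNat W 0) (ho : s.out = []) :
    (rowProgram.run s).out = rowOps L ∧ (rowProgram.run s).steps ≤ s.steps + 30 + 120 * L := by
  have hW : 16 ≤ W := by omega
  have big : 8 + L + L < 2 ^ W := by
    have : W < 2 ^ W := Nat.lt_two_pow_self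
    omega
  have h := controlDone_run hW <| walkUp_run (r := 0) (by norm_num) hW (by omega) <|
    walkUp_run (r := 1) (by norm_num) hW big <| emitSign_run hW big <|
    walkDown_run true (r := 1) (by norm_num) hW big <|
    walkDown_run false (r := 0) (by norm_num) hW (by omega) <| controlInit_run hL hWL r2 r4 ho
  exact ⟨h.1, h.2.trans (by omega)⟩

theorem normsProgram_run {L : ℕ} (hL : 1 ≤ L) (hWL : W = 16 * L) {s : State W}
    (r2 : s.reg 2 = BitVec.ofNat W W) (r4 : s.reg 4 = BitVec.ofNat W 0) (ho : s.out = []) :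
    (normsProgram.run s).out = normsOps L ∧
      (normsProgram.run s).steps ≤ s.steps + 30 + 120 * L := by
  have hW : 16 ≤ W := by omega
  have big : 8 + L < 2 ^ W := by
    have : W < 2 ^ W := Nat.lt_two_pow_self
    omega
  have h := controlDone_run hW <| walkUp_run (r := 0) (by norm_num) hW big <|
    walkDown_run true (r := 0) (by norm_num) hW big <| controlInit_run hL hWL r2 r4 ho
  exact ⟨h.1, h.2.trans (by omega)⟩

theorem walkOps_length (rot : Bool) (r L p d : ℕ) : (walkOps rot r L p d).length ≤ 16 * d := by
  induction d with
  | zero => simp [walkOps]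
  | succ d ih =>
    rw [walkOps, List.range_succ, List.flatMap_append, List.flatMap_singleton, List.length_append]
    rw [walkOps] at ih
    cases rot <;> simp [levelOps, stepOps, rotOps] at ih ⊢ <;> omega

theorem unwalkOps_length (r p d : ℕ) : (unwalkOps r p d).length ≤ 16 * d := by
  induction d with
  | zero => simp [unwalkOps]
  | succ d ih =>
    rw [unwalkOps, List.range_succ, List.flatMap_append, List.flatMap_singleton,
      List.length_append]
    rw [unwalkOps] at ih
    simp [stepOps] at ih ⊢; omega

theorem rowOps_length (L : ℕ) : (rowOps L).length ≤ 7 + 64 * L := by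
  have h1 := walkOps_length false 0 L 8 L
  have h2 := walkOps_length true 1 L (8 + L) L
  have h3 := unwalkOps_length 1 (8 + L + L) L
  have h4 := unwalkOps_length 0 (8 + L) L
  simp only [rowOps, signOps, List.length_append, List.length_cons, List.length_nil]
  omega

theorem normsOps_length (L : ℕ) : (normsOps L).length ≤ 7 + 64 * L := by
  have h1 := walkOps_length true 0 L 8 L
  have h4 := unwalkOps_length 0 (8 + L) L
  simp only [normsOps, List.length_append, List.length_cons, List.length_nil]
  omega

end

section

variable {W : ℕ}

/-! ### The action of the quantum instructions -/

theorem apply_ket (M : Memory W) (g : QOp) (c : Config W) : g.apply M (ket c) = g.onBasis M c := by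
  rw [QOp.apply, ket, Finsupp.linearCombination_single, one_smul]

/-- The action of a sequence of instructions as a linear map. -/
noncomputable def opsMap (M : Memory W) : List QOp → QState W →ₗ[ℂ] QState W
  | [] => .id
  | g :: gs => opsMap M gs ∘ₗ g.apply M

theorem applyAll_eq (M : Memory W) (gs : List QOp) (ψ : QState W) :
    applyAll M gs ψ = opsMap M gs ψ := by
  induction gs generalizing ψ with
  | nil => rfl
  | cons g gs ih => exact ih _

theorem opsMap_append (M : Memory W) (gs hs : List QOp) (ψ : QState W) :
    opsMap M (gs ++ hs) ψ = opsMap M hs (opsMap M gs ψ) := by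
  induction gs generalizing ψ with
  | nil => rfl
  | cons g gs ih => exact ih _

theorem Config.word_setWord (c : Config W) (d x : ℕ) (v : BitVec W) :
    (c.setWord d v).word x = if x = d then v else c.word x := Function.update_apply _ _ _ _

theorem Config.setWord_comm (c : Config W) {d e : ℕ} (h : d ≠ e) (v w : BitVec W) :
    (c.setWord d v).setWord e w = (c.setWord e w).setWord d v := by
  ext1
  · exact Function.update_comm h _ _ _
  · rfl

/-- An XOR writes a value into a zero register, and the same XOR clears it as long as its arguments
are unchanged. The pairs of lemmas `_apply` and `_undo` are the two halves of computing and
uncomputing. -/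
theorem const_apply (M : Memory W) {d k : ℕ} {c : Config W} (h0 : c.word d = 0#W) :
    (QOp.const d k).apply M (ket c) = ket (c.setWord d (BitVec.ofNat W k)) := by
  rw [apply_ket, QOp.onBasis, h0, BitVec.zero_xor]

theorem const_undo (M : Memory W) {d k : ℕ} {c : Config W} (h0 : c.word d = 0#W) :
    (QOp.const d k).apply M (ket (c.setWord d (BitVec.ofNat W k))) = ket c := by
  rw [apply_ket, QOp.onBasis, Config.word_setWord, if_pos rfl, BitVec.xor_self, ← h0]
  congr 1
  ext1
  · simp [Config.setWord]
  · rfl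

theorem op_apply (M : Memory W) (f : WordOp) {d a b : ℕ} {c : Config W} (h0 : c.word d = 0#W)
    (ha : d ≠ a) (hb : d ≠ b) : (QOp.op f d a b).apply M (ket c) =
      ket (c.setWord d (f.eval (c.word a) (c.word b))) := by
  rw [apply_ket, QOp.onBasis, if_neg (by tauto), h0, BitVec.zero_xor]

theorem op_undo (M : Memory W) (f : WordOp) {d a b : ℕ} {c : Config W} {v : BitVec W}
    (h0 : c.word d = 0#W) (ha : d ≠ a) (hb : d ≠ b) (hv : v = f.eval (c.word a) (c.word b)) :
    (QOp.op f d a b).apply M (ket (c.setWord d v)) = ket c := by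
  rw [apply_ket, QOp.onBasis, if_neg (by tauto), Config.word_setWord, if_pos rfl,
    Config.word_setWord, if_neg ha.symm, Config.word_setWord, if_neg hb.symm, hv, BitVec.xor_self,
    ← h0]
  congr 1
  ext1
  · simp [Config.setWord]
  · rfl

theorem query_apply (M : Memory W) {d a : ℕ} (c : Config W) (h : d ≠ a) :
    (QOp.query d a).apply M (ket c) = ket (c.setWord d (c.word d ^^^ M.word (c.word a))) := by
  rw [apply_ket, QOp.onBasis, if_neg h]

/-- The target register `p + 1` need not be zero: the pointer is XORed into it. One statement thus
covers both writing the pointer and erasing it. -/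
theorem opsMap_stepOps (M : Memory W) {r t p : ℕ} (hr : r < 2) (hp : 8 ≤ p) {c : Config W}
    (h2 : c.word 2 = BitVec.ofNat W 1) (h3 : c.word 3 = BitVec.ofNat W 0)
    (h4 : c.word 4 = BitVec.ofNat W 0) (h5 : c.word 5 = BitVec.ofNat W 0)
    (h6 : c.word 6 = BitVec.ofNat W 0) :
    opsMap M (stepOps r t p) (ket c) = ket (c.setWord (p + 1) (c.word (p + 1) ^^^ M.word (c.word p +
      (c.word r >>> (BitVec.ofNat W t).toNat &&& BitVec.ofNat W 1)))) := by
  have w : ∀ (c : Config W) (d x : ℕ) (v : BitVec W), x ≠ d → (c.setWord d v).word x = c.word x :=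
    fun c d x v h => by rw [Config.word_setWord, if_neg h]
  have w' : ∀ (c : Config W) (d : ℕ) (v : BitVec W), (c.setWord d v).word d = v :=
    fun c d v => by rw [Config.word_setWord, if_pos rfl]
  simp only [stepOps, opsMap, LinearMap.comp_apply, LinearMap.id_apply]
  rw [const_apply M h3]
  set c1 := c.setWord 3 (BitVec.ofNat W t) with hc1
  rw [op_apply M .shr (c := c1) (by rw [w _ _ _ _ (by omega), h4]) (by omega) (by omega)]
  set A := WordOp.shr.eval (c1.word r) (c1.word 3) with hA
  set c2 := c1.setWord 4 A with hc2
  rw [op_apply M .and (c := c2) (by rw [w _ _ _ _ (by omega), w _ _ _ _ (by omega), h5])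
    (by omega) (by omega)]
  set B := WordOp.and.eval (c2.word 4) (c2.word 2) with hB
  set c3 := c2.setWord 5 B with hc3
  rw [op_apply M .add (c := c3) (by rw [w _ _ _ _ (by omega), w _ _ _ _ (by omega),
    w _ _ _ _ (by omega), h6]) (by omega) (by omega)]
  set S := WordOp.add.eval (c3.word p) (c3.word 5) with hS
  rw [query_apply M _ (by omega)]
  have eA : A = c.word r >>> (BitVec.ofNat W t).toNat := by
    rw [hA, hc1, w', w _ _ _ _ (by omega)]; rfl
  have eB : B = A &&& BitVec.ofNat W 1 := by
    rw [hB, hc2, w', w _ _ _ _ (by omega), hc1, w _ _ _ _ (by omega), h2]; rfl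
  have eS : S = c.word p + B := by
    rw [hS, hc3, w', w _ _ _ _ (by omega), hc2, w _ _ _ _ (by omega), hc1, w _ _ _ _ (by omega)]
    rfl
  rw [w', w _ _ _ _ (by omega), hc3, w _ _ _ _ (by omega), hc2, w _ _ _ _ (by omega), hc1,
    w _ _ _ _ (by omega), ← eA, ← eB, ← eS]
  set v := c.word (p + 1) ^^^ M.word S
  -- Moving the write to `p + 1` innermost leaves the four scratch writes outermost, and the second
  -- half of the instructions removes them in reverse order.
  rw [Config.setWord_comm _ (show 6 ≠ p + 1 by omega),
    Config.setWord_comm _ (show 5 ≠ p + 1 by omega),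
    Config.setWord_comm _ (show 4 ≠ p + 1 by omega),
    Config.setWord_comm _ (show 3 ≠ p + 1 by omega)]
  set e := c.setWord (p + 1) v with he
  rw [op_undo M .add ?_ (by omega) (by omega), op_undo M .and ?_ (by omega) (by omega),
    op_undo M .shr ?_ (by omega) (by omega), const_undo M]
  · rw [he, w _ _ _ _ (by omega), h3]
  · rw [eA, w', w _ _ _ _ (by omega), he, w _ _ _ _ (by omega)]; rfl
  · rw [w _ _ _ _ (by omega), he, w _ _ _ _ (by omega), h4]
  · rw [eB, w', w _ _ _ _ (by omega), w _ _ _ _ (by omega), he, w _ _ _ _ (by omega), h2]; rfl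
  · rw [w _ _ _ _ (by omega), w _ _ _ _ (by omega), he, w _ _ _ _ (by omega), h5]
  · rw [eS, w', w _ _ _ _ (by omega), w _ _ _ _ (by omega), w _ _ _ _ (by omega), he,
      w _ _ _ _ (by omega)]; rfl
  · rw [w _ _ _ _ (by omega), w _ _ _ _ (by omega), w _ _ _ _ (by omega), he,
      w _ _ _ _ (by omega), h6]

theorem realQuery_apply (M : Memory W) {x a : ℕ} {c : Config W} (h0 : c.real x = 0) :
    (QOp.realQuery x a).apply M (ket c) = ket (c.setReal x (M.real (c.word a))) := by
  rw [apply_ket, QOp.onBasis, h0, zero_add]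

theorem realQuery_undo (M : Memory W) {x a : ℕ} {c : Config W} (h0 : c.real x = 0) {v : ℝ}
    (hv : v = M.real (c.word a)) :
    (QOp.realQueryInv x a).apply M (ket (c.setReal x v)) = ket c := by
  rw [apply_ket, QOp.onBasis, hv]
  congr 1
  ext1
  · rfl
  · simp [Config.setReal, ← h0]

/-- The rotation controlled by the numbers at the node with address in register `p`. -/
theorem opsMap_rotOps (M : Memory W) {r t p : ℕ} (hr : r < 2) (ht : t < W) (hp : 8 ≤ p)
    {c c' : Config W} (h2 : c.word 2 = BitVec.ofNat W 1) (h6 : c.word 6 = BitVec.ofNat W 0)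
    (hreal : c.real = 0) (hbit : (c.word r).getLsbD t = false)
    (hc' : c' = c.setWord r (c.word r ^^^ BitVec.twoPow W t)) {X Y : ℝ}
    (eX : M.real (c.word p) = X) (eY : M.real (c.word p + BitVec.ofNat W 1) = Y)
    (hX : 0 ≤ X) (hY : 0 ≤ Y) (hXY : 0 < X + Y) :
    opsMap M (rotOps r t p) (ket c) = ((√(X / (X + Y)) : ℝ) : ℂ) • ket c +
      ((√(Y / (X + Y)) : ℝ) : ℂ) • ket c' := by
  have w : ∀ (c : Config W) (d x : ℕ) (v : BitVec W), x ≠ d → (c.setWord d v).word x = c.word x :=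
    fun c d x v h => by rw [Config.word_setWord, if_neg h]
  have w' : ∀ (c : Config W) (d : ℕ) (v : BitVec W), (c.setWord d v).word d = v :=
    fun c d v => by rw [Config.word_setWord, if_pos rfl]
  have h0 : ∀ x, c.real x = 0 := fun x => by rw [hreal]; rfl
  -- Uncomputing looks only at registers that the rotation does not touch, so it clears the scratch
  -- space in both branches.
  have undo : ∀ e : Config W, e.word 2 = c.word 2 → e.word 6 = 0#W → e.word p = c.word p →
      e.real = 0 →
      (QOp.op .add 6 p 2).apply M ((QOp.realQueryInv 0 p).apply M ((QOp.realQueryInv 1 6).apply M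
        (ket (((e.setWord 6 (c.word p + BitVec.ofNat W 1)).setReal 0 X).setReal 1 Y)))) =
      ket e := by
    intro e e2 e6 ep er
    have er' : ∀ x, e.real x = 0 := fun x => by rw [er]; rfl
    rw [realQuery_undo M, realQuery_undo M, op_undo M .add e6 (by omega) (by omega)]
    · rw [ep, e2, h2]; rfl
    · exact er' 0
    · rw [w _ _ _ _ (by omega), ep, eX]
    · exact er' 1
    · rw [← eY]; congr 1
  simp only [rotOps, opsMap, LinearMap.comp_apply, LinearMap.id_apply]
  rw [op_apply M .add h6 (by omega) (by omega), h2,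
    show WordOp.add.eval (c.word p) (BitVec.ofNat W 1) = c.word p + BitVec.ofNat W 1 from rfl,
    realQuery_apply M (c := c.setWord 6 (c.word p + BitVec.ofNat W 1)) (h0 0),
    w _ _ _ _ (by omega), eX,
    realQuery_apply M (x := 1)
      (c := (c.setWord 6 (c.word p + BitVec.ofNat W 1)).setReal 0 X) (h0 1),
    show M.real (((c.setWord 6 (c.word p + BitVec.ofNat W 1)).setReal 0 X).word 6) = Y by
      rw [← eY]; congr 1]
  set u := ((c.setWord 6 (c.word p + BitVec.ofNat W 1)).setReal 0 X).setReal 1 Y with hu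
  have ur : u.word r = c.word r := w _ _ _ _ (by omega)
  have u0 : u.real 0 = X := by simp [hu, Config.setReal]
  have u1 : u.real 1 = Y := by simp [hu, Config.setReal]
  have uf : u.setWord r (c.word r ^^^ BitVec.twoPow W t) =
      ((c'.setWord 6 (c.word p + BitVec.ofNat W 1)).setReal 0 X).setReal 1 Y := by
    rw [hc', Config.setWord_comm _ (show r ≠ 6 by omega)]; rfl
  have rot : (QOp.rotate r t 0 1).apply M (ket u) = ((√(X / (X + Y)) : ℝ) : ℂ) • ket u +
      ((√(Y / (X + Y)) : ℝ) : ℂ) • ket (u.setWord r (c.word r ^^^ BitVec.twoPow W t)) := by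
    simp only [apply_ket, QOp.onBasis, u0, u1, ur, hbit]
    rw [if_pos ⟨ht, hX, hY, hXY⟩]
    simp
  rw [rot, uf]
  simp only [map_add, map_smul]
  rw [hu, undo c rfl h6 rfl hreal, undo c' _ _ _ _]
  · rw [hc', w _ _ _ _ (by omega)]
  · rw [hc', w _ _ _ _ (by omega), h6]
  · rw [hc', w _ _ _ _ (by omega)]
  · rw [hc']; exact hreal

theorem opsMap_signOps (M : Memory W) {p : ℕ} {c : Config W} (hreal : c.real = 0) {X : ℝ}
    (eX : M.real (c.word p) = X) :
    opsMap M (signOps p) (ket c) = ((if X < 0 then -1 else 1 : ℝ) : ℂ) • ket c := by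
  have h0 : ∀ x, c.real x = 0 := fun x => by rw [hreal]; rfl
  have u0 : (c.setReal 0 X).real 0 = X := by simp [Config.setReal]
  simp only [signOps, opsMap, LinearMap.comp_apply, LinearMap.id_apply]
  rw [realQuery_apply M (h0 0), eX]
  have sgn : (QOp.signFlip 0).apply M (ket (c.setReal 0 X)) =
      ((if X < 0 then -1 else 1 : ℝ) : ℂ) • ket (c.setReal 0 X) := by
    simp only [apply_ket, QOp.onBasis, u0]
    split_ifs <;> simp
  rw [sgn, map_smul, realQuery_undo M (h0 0) eX.symm]

/-! ### Paths in the tree -/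

/-- The address of the node with heap index `h`, found by following the pointers in the memory. -/
def nodePointer (M : Memory W) (h : ℕ) : BitVec W :=
  if h ≤ 1 then BitVec.ofNat W 2
  else M.word (nodePointer M (h / 2) + BitVec.ofNat W (h % 2))
termination_by h

theorem nodePointer_child (M : Memory W) {h : ℕ} (h1 : 1 < h) :
    nodePointer M h = M.word (nodePointer M (h / 2) + BitVec.ofNat W (h % 2)) := by
  rw [nodePointer, if_neg (by omega)]

theorem TreeInv.nodePointer_eq {M : Memory W} {N k F} (I : TreeInv M N k F) {h : ℕ}
    (hn : N h ≠ 0) : nodePointer M h = BitVec.ofNat W (N h) := by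
  induction h using Nat.strong_induction_on with
  | _ h ih =>
    have h1 := I.index_pos hn
    by_cases h2 : h = 1
    · rw [h2, nodePointer, if_pos le_rfl, I.root]
    · have e : 2 * (h / 2) + h % 2 = h := by omega
      have hb : h % 2 < 2 := Nat.mod_lt _ two_pos
      have hp := I.parent (h / 2) (h % 2) (by omega) hb (by rwa [e])
      rw [nodePointer_child M (by omega), ih _ (by omega) hp, ← BitVec.ofNat_add,
        I.child _ _ hp hb, e]

/-- The configuration with `i` and `j` in registers `0` and `1` in which the pointers to the first
`D + 1` nodes on the path to the leaf for `i`, `j` have been computed. -/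
def pathConfig (M : Memory W) (L i j D : ℕ) : Config W where
  word r :=
    if r = 0 then BitVec.ofNat W i
    else if r = 1 then BitVec.ofNat W j
    else if r = 2 then BitVec.ofNat W 1
    else if 8 ≤ r ∧ r ≤ 8 + D then nodePointer M (leafIndex L i j / 2 ^ (2 * L - (r - 8)))
    else BitVec.ofNat W 0
  real := 0

theorem pathConfig_pointer (M : Memory W) (L i j : ℕ) {D d : ℕ} (h : d ≤ D) :
    (pathConfig M L i j D).word (8 + d) = nodePointer M (leafIndex L i j / 2 ^ (2 * L - d)) := by
  simp only [pathConfig]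
  rw [if_neg (by omega), if_neg (by omega), if_neg (by omega), if_pos (by omega),
    Nat.add_sub_cancel_left]

theorem pathConfig_succ (M : Memory W) (L i j D : ℕ) :
    pathConfig M L i j (D + 1) = (pathConfig M L i j D).setWord (8 + D + 1)
      (nodePointer M (leafIndex L i j / 2 ^ (2 * L - (D + 1)))) := by
  ext1
  · funext r
    rw [Config.word_setWord]
    split_ifs with h
    · rw [h]; exact pathConfig_pointer M L i j le_rfl
    · simp only [pathConfig]
      have : r ≤ 8 + (D + 1) ↔ r ≤ 8 + D := by omega
      simp only [this]
  · rfl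

theorem leafIndex_bit_right {L i j t : ℕ} (ht : t < L) :
    leafIndex L i j / 2 ^ t % 2 = j / 2 ^ t % 2 := by
  have e : leafIndex L i j = j + 2 ^ t * (2 * ((2 ^ L + i) * 2 ^ (L - 1 - t))) := by
    have : 2 ^ L = 2 ^ t * (2 * 2 ^ (L - 1 - t)) := by
      rw [← pow_succ', ← pow_add]; congr 1; omega
    rw [leafIndex]
    conv_lhs => rw [add_comm]; arg 2; arg 2; rw [this]
    ring
  rw [e, Nat.add_mul_div_left _ _ (Nat.two_pow_pos t), Nat.add_mul_mod_self_left]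

theorem leafIndex_bit_left {L i j t : ℕ} (ht : t < L) (hj : j < 2 ^ L) :
    leafIndex L i j / 2 ^ (L + t) % 2 = i / 2 ^ t % 2 := by
  have e : leafIndex L i j / 2 ^ L = i + 2 ^ t * (2 * 2 ^ (L - 1 - t)) := by
    have : 2 ^ L = 2 ^ t * (2 * 2 ^ (L - 1 - t)) := by
      rw [← pow_succ', ← pow_add]; congr 1; omega
    rw [leafIndex, add_comm, Nat.add_mul_div_right _ _ (Nat.two_pow_pos L),
      Nat.div_eq_of_lt hj, zero_add, add_comm, ← this]
  rw [pow_add, ← Nat.div_div_eq_div_mul, e, Nat.add_mul_div_left _ _ (Nat.two_pow_pos t),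
    Nat.add_mul_mod_self_left]

/-- The register and the qubit that select the next node at depth `D`. -/
structure Selects (L r t D : ℕ) : Prop where
  out : r = 0 ∧ t + 1 + D = L ∨ r = 1 ∧ t < L ∧ t + 1 + D = 2 * L

/-- The leaf index has the bits of `j` in its lower half and those of `i` above them. The selected
bit is therefore the last bit of the heap index of the next node on the path. -/
theorem pathConfig_bit (M : Memory W) {L r t D i j E : ℕ} (hS : Selects L r t D)
    (hLW : 2 * L < W) (hi : i < 2 ^ L) (hj : j < 2 ^ L) :
    (pathConfig M L i j E).word r >>> (BitVec.ofNat W t).toNat &&& BitVec.ofNat W 1 =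
      BitVec.ofNat W (leafIndex L i j / 2 ^ (2 * L - (D + 1)) % 2) := by
  have hL : 2 ^ L < 2 ^ W := Nat.pow_lt_pow_right (by norm_num) (by omega)
  have hW : W < 2 ^ W := Nat.lt_two_pow_self
  obtain ⟨⟨rfl, ht⟩ | ⟨rfl, h1, ht⟩⟩ := hS
  · have : (pathConfig M L i j E).word 0 = BitVec.ofNat W i := rfl
    rw [this, bit_ofNat (by omega) (by omega) (by omega),
      show 2 * L - (D + 1) = L + t by omega, leafIndex_bit_left (by omega) hj]
  · have : (pathConfig M L i j E).word 1 = BitVec.ofNat W j := rfl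
    rw [this, bit_ofNat (by omega) (by omega) (by omega),
      show 2 * L - (D + 1) = t by omega, leafIndex_bit_right (by omega)]

end

/-! ### Walks and rotations in superposition -/

section

variable {W : ℕ}

theorem Selects.lt {L r t D : ℕ} (hS : Selects L r t D) : D < 2 * L := by
  have := hS.out; omega

theorem Selects.reg_lt {L r t D : ℕ} (hS : Selects L r t D) : r < 2 := by
  have := hS.out; omega

theorem depth_bounds {T l D : ℕ} (hl : 2 ^ T ≤ l) (hl2 : l < 2 ^ (T + 1)) (hD : D ≤ T) :
    2 ^ D ≤ l / 2 ^ (T - D) ∧ l / 2 ^ (T - D) < 2 ^ (D + 1) := by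
  rw [Nat.le_div_iff_mul_le (Nat.two_pow_pos _), Nat.div_lt_iff_lt_mul (Nat.two_pow_pos _),
    ← pow_add, ← pow_add, show D + (T - D) = T by omega, show D + 1 + (T - D) = T + 1 by omega]
  exact ⟨hl, hl2⟩

theorem nodePointer_step (M : Memory W) (L i j : ℕ) {D : ℕ} (hD : D < 2 * L) :
    nodePointer M (leafIndex L i j / 2 ^ (2 * L - (D + 1))) =
      M.word (nodePointer M (leafIndex L i j / 2 ^ (2 * L - D)) +
        BitVec.ofNat W (leafIndex L i j / 2 ^ (2 * L - (D + 1)) % 2)) := by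
  have h1 : 2 ^ (D + 1) ≤ leafIndex L i j / 2 ^ (2 * L - (D + 1)) := by
    rw [Nat.le_div_iff_mul_le (Nat.two_pow_pos _), ← pow_add,
      show D + 1 + (2 * L - (D + 1)) = 2 * L by omega]
    exact le_leafIndex L i j
  have h2 : 1 < 2 ^ (D + 1) := Nat.one_lt_two_pow (by omega)
  rw [nodePointer_child M (by omega), Nat.div_div_eq_div_mul, ← pow_succ,
    show 2 * L - (D + 1) + 1 = 2 * L - D by omega]

theorem pathConfig_zero_above (M : Memory W) (L i j D : ℕ) :
    (pathConfig M L i j D).word (8 + D + 1) = 0#W := by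
  simp only [pathConfig]
  rw [if_neg (by omega), if_neg (by omega), if_neg (by omega), if_neg (by omega)]

/-- With `E = D` the new pointer is written, with `E = D + 1` it is erased. The nodes need not be
stored: below a missing node `nodePointer` is some word read from memory, the same on the way down
and on the way up. -/
theorem opsMap_step (M : Memory W) {L r t D i j E : ℕ} (hS : Selects L r t D) (hLW : 2 * L < W)
    (hi : i < 2 ^ L) (hj : j < 2 ^ L) (hE : D ≤ E) :
    opsMap M (stepOps r t (8 + D)) (ket (pathConfig M L i j E)) =
      ket ((pathConfig M L i j E).setWord (8 + D + 1) ((pathConfig M L i j E).word (8 + D + 1) ^^^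
        nodePointer M (leafIndex L i j / 2 ^ (2 * L - (D + 1))))) := by
  rw [opsMap_stepOps M hS.reg_lt (by omega) rfl rfl rfl rfl rfl, pathConfig_bit M hS hLW hi hj,
    pathConfig_pointer M L i j hE, nodePointer_step M L i j hS.lt]

theorem opsMap_step_down (M : Memory W) {L r t D i j : ℕ} (hS : Selects L r t D) (hLW : 2 * L < W)
    (hi : i < 2 ^ L) (hj : j < 2 ^ L) :
    opsMap M (stepOps r t (8 + D)) (ket (pathConfig M L i j D)) =
      ket (pathConfig M L i j (D + 1)) := by
  rw [opsMap_step M hS hLW hi hj le_rfl, pathConfig_zero_above, BitVec.zero_xor, pathConfig_succ]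

theorem opsMap_step_up (M : Memory W) {L r t D i j : ℕ} (hS : Selects L r t D) (hLW : 2 * L < W)
    (hi : i < 2 ^ L) (hj : j < 2 ^ L) :
    opsMap M (stepOps r t (8 + D)) (ket (pathConfig M L i j (D + 1))) =
      ket (pathConfig M L i j D) := by
  rw [opsMap_step M hS hLW hi hj (by omega), add_assoc, pathConfig_pointer M L i j le_rfl,
    BitVec.xor_self, pathConfig_succ, ← pathConfig_zero_above M L i j D]
  congr 1
  ext1
  · simp [Config.setWord, add_assoc]
  · rfl

theorem opsMap_walk (M : Memory W) {L r D d i j : ℕ} (hLW : 2 * L < W) (hi : i < 2 ^ L)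
    (hj : j < 2 ^ L) (hS : ∀ k < d, Selects L r (L - 1 - k) (D + k)) :
    opsMap M (walkOps false r L (8 + D) d) (ket (pathConfig M L i j D)) =
      ket (pathConfig M L i j (D + d)) := by
  induction d with
  | zero => rfl
  | succ d ih =>
    have := ih fun k hk => hS k (by omega)
    rw [walkOps] at this ⊢
    rw [List.range_succ, List.flatMap_append, List.flatMap_singleton, opsMap_append, this,
      levelOps, if_neg Bool.false_ne_true, List.nil_append, add_assoc 8 D d,
      opsMap_step_down M (hS d (by omega)) hLW hi hj, add_assoc D d 1]

theorem opsMap_unwalk (M : Memory W) {L r D d i j : ℕ} (hLW : 2 * L < W) (hi : i < 2 ^ L)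
    (hj : j < 2 ^ L) (hd : d ≤ D) (hS : ∀ k < d, Selects L r k (D - 1 - k)) :
    opsMap M (unwalkOps r (8 + D) d) (ket (pathConfig M L i j D)) =
      ket (pathConfig M L i j (D - d)) := by
  induction d with
  | zero => rfl
  | succ d ih =>
    have := ih (by omega) fun k hk => hS k (by omega)
    rw [unwalkOps] at this ⊢
    rw [List.range_succ, List.flatMap_append, List.flatMap_singleton, opsMap_append, this,
      show 8 + D - 1 - d = 8 + (D - 1 - d) by omega, show D - d = (D - 1 - d) + 1 by omega,
      opsMap_step_up M (hS d (by omega)) hLW hi hj, show D - (d + 1) = D - 1 - d by omega]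

/-- A node of positive weight must be stored, since the cell values below a missing node are `0`.
This is what allows the rotation to trust the numbers it reads. -/
theorem TreeInv.node_real {M : Memory W} {N k V} {T : ℕ} (I : TreeInv M N k (cellValue T V))
    {d h : ℕ} (hd : d < T) (h1 : 2 ^ d ≤ h) (h2 : h < 2 ^ (d + 1))
    (hpos : 0 < subtreeSum V (T - d) h) {b : ℕ} (hb : b < 2) :
    M.real (nodePointer M h + BitVec.ofNat W b) = subtreeSum V (T - (d + 1)) (2 * h + b) := by
  have F : ∀ b < 2, cellValue T V (2 * h + b) = subtreeSum V (T - (d + 1)) (2 * h + b) := by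
    intro b hb
    refine cellValue_node V (by omega) ?_ ?_
    · rw [pow_succ]; omega
    · rw [pow_succ]; omega
  have hn : N h ≠ 0 := by
    intro hn
    have hh : 1 ≤ h := le_trans Nat.one_le_two_pow h1
    have e0 := I.cellZero h 0 hh hn two_pos
    have e1 := I.cellZero h 1 hh hn one_lt_two
    rw [F 0 two_pos] at e0
    rw [F 1 one_lt_two] at e1
    rw [show T - d = T - (d + 1) + 1 by omega, subtreeSum, e1] at hpos
    rw [add_zero] at e0
    rw [e0] at hpos
    simp at hpos
  rw [I.nodePointer_eq hn, ← BitVec.ofNat_add, I.cell h b hn hb, F b hb]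

/-- The two branches have the same pointers up to depth `D`, because these do not depend on the
rotated bit; the step that follows gives each branch its own child. A child of weight `0` may be
missing, but its coefficient is then `0`. -/
theorem opsMap_level_rot {M : Memory W} {N k V} {L : ℕ} (I : TreeInv M N k (cellValue (2 * L) V))
    {r t D i j i' j' h : ℕ} (hS : Selects L r t D) (hLW : 2 * L < W)
    (hi : i < 2 ^ L) (hj : j < 2 ^ L) (hi' : i' < 2 ^ L) (hj' : j' < 2 ^ L)
    (hh : leafIndex L i j / 2 ^ (2 * L - D) = h)
    (hbit : ((pathConfig M L i j D).word r).getLsbD t = false)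
    (hflip : pathConfig M L i' j' D = (pathConfig M L i j D).setWord r
      ((pathConfig M L i j D).word r ^^^ BitVec.twoPow W t))
    (hpos : 0 < subtreeSum V (2 * L - D) h) :
    opsMap M (levelOps true r t (8 + D)) (ket (pathConfig M L i j D)) =
      ((√(subtreeSum V (2 * L - (D + 1)) (2 * h) / subtreeSum V (2 * L - D) h) : ℝ) : ℂ) •
        ket (pathConfig M L i j (D + 1)) +
      ((√(subtreeSum V (2 * L - (D + 1)) (2 * h + 1) / subtreeSum V (2 * L - D) h) : ℝ) : ℂ) •
        ket (pathConfig M L i' j' (D + 1)) := by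
  have hD := hS.lt
  obtain ⟨b1, b2⟩ := depth_bounds (le_leafIndex L i j) (leafIndex_lt hi hj) hD.le
  rw [hh] at b1 b2
  have sum : subtreeSum V (2 * L - D) h = subtreeSum V (2 * L - (D + 1)) (2 * h) +
      subtreeSum V (2 * L - (D + 1)) (2 * h + 1) := by
    rw [show 2 * L - D = 2 * L - (D + 1) + 1 by omega, subtreeSum]
  have eX := I.node_real hD b1 b2 hpos two_pos
  have eY := I.node_real hD b1 b2 hpos one_lt_two
  rw [BitVec.add_zero, add_zero] at eX
  have ht : t < W := by have := hS.out; omega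
  have hp : (pathConfig M L i j D).word (8 + D) = nodePointer M h := by
    rw [pathConfig_pointer M L i j le_rfl, hh]
  rw [levelOps, if_pos rfl, opsMap_append, opsMap_rotOps M hS.reg_lt ht (by omega) rfl rfl rfl hbit
    hflip (by rw [hp, eX]) (by rw [hp, eY]) (subtreeSum_nonneg _ _ _) (subtreeSum_nonneg _ _ _)
    (by rwa [← sum]), map_add, map_smul, map_smul, opsMap_step_down M hS hLW hi hj,
    opsMap_step_down M hS hLW hi' hj', ← sum]

/-- Successive rotations split every basis state into two with weights that add up; after `d`
rotations the squares of the amplitudes are proportional to the weights. -/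
theorem opsMap_superpose (M : Memory W) {S : ℕ → ℕ → ℝ} {c : ℕ → ℕ → Config W}
    {ops : ℕ → List QOp} {n : ℕ} (hS : ∀ d q, 0 ≤ S d q)
    (hadd : ∀ d < n, ∀ q, S d q = S (d + 1) (2 * q) + S (d + 1) (2 * q + 1))
    (hstep : ∀ d < n, ∀ q < 2 ^ d, 0 < S d q → opsMap M (ops d) (ket (c d q)) =
      ((√(S (d + 1) (2 * q) / S d q) : ℝ) : ℂ) • ket (c (d + 1) (2 * q)) +
      ((√(S (d + 1) (2 * q + 1) / S d q) : ℝ) : ℂ) • ket (c (d + 1) (2 * q + 1)))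
    (h0 : 0 < S 0 0) {d : ℕ} (hd : d ≤ n) :
    opsMap M ((List.range d).flatMap ops) (ket (c 0 0)) =
      ∑ q ∈ Finset.range (2 ^ d), ((√(S d q / S 0 0) : ℝ) : ℂ) • ket (c d q) := by
  induction d with
  | zero => simp [opsMap, h0.ne']
  | succ d ih =>
    rw [List.range_succ, List.flatMap_append, List.flatMap_singleton, opsMap_append,
      ih (by omega), map_sum, pow_succ', sum_range_two_mul]
    refine Finset.sum_congr rfl fun q hq => ?_
    rw [map_smul]
    -- The weight of the intermediate node cancels.
    have split : ∀ x, 0 < S d q → √(S d q / S 0 0) * √(x / S d q) = √(x / S 0 0) := by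
      intro x hpos
      rw [← Real.sqrt_mul (div_nonneg hpos.le h0.le)]
      congr 1
      field_simp
    rcases (hS d q).lt_or_eq with hpos | hz
    · rw [hstep d (by omega) q (Finset.mem_range.1 hq) hpos, smul_add, smul_smul, smul_smul,
        ← Complex.ofReal_mul, ← Complex.ofReal_mul, split _ hpos, split _ hpos]
    -- A branch of weight `0` has amplitude `0`, and nonnegativity forces both children to have
    -- weight `0`, so it does not matter what the instructions do there.
    · have := hadd d (by omega) q
      have p1 := hS (d + 1) (2 * q)
      have p2 := hS (d + 1) (2 * q + 1)
      rw [← hz, show S (d + 1) (2 * q) = 0 by linarith,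
        show S (d + 1) (2 * q + 1) = 0 by linarith]
      simp

theorem flip_bit (q t : ℕ) : BitVec.ofNat W (2 * q * 2 ^ t) ^^^ BitVec.twoPow W t =
    BitVec.ofNat W ((2 * q + 1) * 2 ^ t) := by
  have : BitVec.twoPow W t = BitVec.ofNat W (2 ^ t) := by
    apply BitVec.eq_of_toNat_eq
    rw [BitVec.toNat_twoPow, BitVec.toNat_ofNat]
  rw [this, ← BitVec.ofNat_xor]
  congr 1
  have := Nat.shiftLeft_xor_distrib (i := t) (a := 2 * q) (b := 1)
  rw [Nat.xor_one_of_even (even_two_mul q), Nat.shiftLeft_eq, Nat.shiftLeft_eq, Nat.shiftLeft_eq,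
    one_mul] at this
  exact this.symm

theorem bit_false {q t : ℕ} : (BitVec.ofNat W (2 * q * 2 ^ t)).getLsbD t = false := by
  rw [BitVec.getLsbD_ofNat, Nat.testBit_eq_decide_div_mod_eq,
    Nat.mul_div_cancel _ (Nat.two_pow_pos t)]
  simp

theorem leafIndex_div_right {L i x t : ℕ} (ht : t ≤ L) :
    leafIndex L i (x * 2 ^ t) / 2 ^ t = (2 ^ L + i) * 2 ^ (L - t) + x := by
  have : 2 ^ L = 2 ^ (L - t) * 2 ^ t := by rw [← pow_add]; congr 1; omega
  rw [leafIndex]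
  conv_lhs => arg 1; arg 1; arg 2; rw [this]
  rw [← mul_assoc, ← add_mul, Nat.mul_div_cancel _ (Nat.two_pow_pos t)]

theorem leafIndex_div_left {L x j t : ℕ} (ht : t ≤ L) (hj : j < 2 ^ L) :
    leafIndex L (x * 2 ^ t) j / 2 ^ (L + t) = 2 ^ (L - t) + x := by
  have : 2 ^ L = 2 ^ (L - t) * 2 ^ t := by rw [← pow_add]; congr 1; omega
  rw [pow_add, ← Nat.div_div_eq_div_mul, leafIndex, add_comm,
    Nat.add_mul_div_right _ _ (Nat.two_pow_pos L), Nat.div_eq_of_lt hj, zero_add]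
  conv_lhs => arg 1; arg 1; rw [this]
  rw [← add_mul, Nat.mul_div_cancel _ (Nat.two_pow_pos t)]

/-- Two leaves whose indices differ by the bit at position `s` have the same ancestors above it. -/
theorem ancestors_eq {l l' s y e : ℕ} (h : l / 2 ^ s = 2 * y) (h' : l' / 2 ^ s = 2 * y + 1)
    (he : s + 1 ≤ e) : l / 2 ^ e = l' / 2 ^ e := by
  obtain ⟨u, rfl⟩ := Nat.exists_eq_add_of_le he
  rw [pow_add, pow_succ, ← Nat.div_div_eq_div_mul, ← Nat.div_div_eq_div_mul,
    ← Nat.div_div_eq_div_mul, ← Nat.div_div_eq_div_mul, h, h']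
  congr 1; omega

/-- All pointers up to depth `D` belong to ancestors above the bit `t`, where the two leaf indices
agree. Flipping the bit thus changes only the index register. -/
theorem pathConfig_flip_right (M : Memory W) {L i q t D : ℕ} (ht : t < L)
    (hD : t + 1 + D = 2 * L) :
    pathConfig M L i ((2 * q + 1) * 2 ^ t) D = (pathConfig M L i (2 * q * 2 ^ t) D).setWord 1
      ((pathConfig M L i (2 * q * 2 ^ t) D).word 1 ^^^ BitVec.twoPow W t) := by
  have e1 : (pathConfig M L i (2 * q * 2 ^ t) D).word 1 = BitVec.ofNat W (2 * q * 2 ^ t) := rfl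
  rw [e1, flip_bit]
  ext1
  · funext r
    rw [Config.word_setWord]
    split_ifs with h
    · rw [h]; rfl
    · simp only [pathConfig, if_neg h]
      split_ifs with h0 h1 h2
      · rfl
      · rfl
      · rw [ancestors_eq (l := leafIndex L i (2 * q * 2 ^ t)) (s := t)
          (y := (2 ^ L + i) * 2 ^ (L - (t + 1)) + q)
          (l' := leafIndex L i ((2 * q + 1) * 2 ^ t)) _ _ (by omega)]
        · rw [leafIndex_div_right ht.le, show L - t = L - (t + 1) + 1 by omega, pow_succ]; ring
        · rw [leafIndex_div_right ht.le, show L - t = L - (t + 1) + 1 by omega, pow_succ]; ring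
      · rfl
  · rfl

theorem pathConfig_flip_left (M : Memory W) {L j q t D : ℕ} (hj : j < 2 ^ L)
    (hD : t + 1 + D = L) :
    pathConfig M L ((2 * q + 1) * 2 ^ t) j D = (pathConfig M L (2 * q * 2 ^ t) j D).setWord 0
      ((pathConfig M L (2 * q * 2 ^ t) j D).word 0 ^^^ BitVec.twoPow W t) := by
  have e1 : (pathConfig M L (2 * q * 2 ^ t) j D).word 0 = BitVec.ofNat W (2 * q * 2 ^ t) := rfl
  rw [e1, flip_bit]
  ext1
  · funext r
    rw [Config.word_setWord]
    split_ifs with h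
    · rw [h]; rfl
    · simp only [pathConfig, if_neg h]
      split_ifs with h0 h1 h2
      · rfl
      · rfl
      · rw [ancestors_eq (l := leafIndex L (2 * q * 2 ^ t) j) (s := L + t)
          (y := 2 ^ (L - (t + 1)) + q)
          (l' := leafIndex L ((2 * q + 1) * 2 ^ t) j) _ _ (by omega)]
        · rw [leafIndex_div_left (by omega) hj, show L - t = L - (t + 1) + 1 by omega, pow_succ]
          ring
        · rw [leafIndex_div_left (by omega) hj, show L - t = L - (t + 1) + 1 by omega, pow_succ]
          ring
      · rfl
  · rfl

end

/-! ### The two state preparations -/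

section

variable {W : ℕ}

theorem pathConfig_start (M : Memory W) {L i j : ℕ} (hi : i < 2 ^ L) (hj : j < 2 ^ L) :
    ket (pathConfig M L i j 0) = ket ((Config.setWord (Config.setWord
      ⟨fun r => if r = 0 then BitVec.ofNat W i else if r = 1 then BitVec.ofNat W j else 0#W,
        fun _ => 0⟩ 2 (BitVec.ofNat W 1)) 8 (BitVec.ofNat W 2))) := by
  have h1 := div_depth (le_leafIndex L i j) (leafIndex_lt hi hj)
  congr 1
  ext1
  · funext r
    by_cases h8 : r = 8
    · rw [h8, Config.word_setWord, if_pos rfl]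
      have := pathConfig_pointer M L i j (d := 0) (D := 0) le_rfl
      rw [h1, nodePointer, if_pos le_rfl] at this
      exact this
    · simp only [Config.word_setWord, pathConfig]
      rw [if_neg h8]
      split_ifs <;> first | rfl | omega
  · rfl

theorem opsMap_start (M : Memory W) {L i j : ℕ} (hi : i < 2 ^ L) (hj : j < 2 ^ L) :
    opsMap M [.const 2 1, .const 8 2] (ket₂ W i j) = ket (pathConfig M L i j 0) := by
  simp only [opsMap, LinearMap.comp_apply, LinearMap.id_apply, ket₂]
  rw [const_apply M rfl, const_apply M rfl, pathConfig_start M hi hj]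

theorem opsMap_finish (M : Memory W) {L i j : ℕ} (hi : i < 2 ^ L) (hj : j < 2 ^ L) :
    opsMap M [.const 8 2, .const 2 1] (ket (pathConfig M L i j 0)) = ket₂ W i j := by
  simp only [opsMap, LinearMap.comp_apply, LinearMap.id_apply, ket₂]
  rw [pathConfig_start M hi hj, const_undo M rfl, const_undo M rfl]

theorem TreeInv.leaf_real {M : Memory W} {N k V} {T : ℕ} (I : TreeInv M N k (cellValue T V))
    {l : ℕ} (h1 : 2 ^ T ≤ l) (h2 : l < 2 ^ (T + 1)) (hV : V l ≠ 0) :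
    M.real (nodePointer M l) = V l := by
  have F := cellValue_leaf V h1 h2
  have hn : N l ≠ 0 := by
    intro hn
    have e0 := I.cellZero l 0 (le_trans Nat.one_le_two_pow h1) hn two_pos
    rw [add_zero, F] at e0
    exact hV e0
  have := I.cell l 0 hn two_pos
  rwa [add_zero, add_zero, F, ← I.nodePointer_eq hn] at this

theorem opsMap_rowOps {M : Memory W} {N k V} {L : ℕ} (I : TreeInv M N k (cellValue (2 * L) V))
    (hLW : 2 * L < W) {i : ℕ} (hi : i < 2 ^ L) (hpos : 0 < subtreeSum V L (2 ^ L + i)) :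
    opsMap M (rowOps L) (ket₂ W i 0) = ∑ q ∈ Finset.range (2 ^ L),
      ((V (leafIndex L i q) / √(subtreeSum V L (2 ^ L + i)) : ℝ) : ℂ) • ket₂ W i q := by
  have hL : (0 : ℕ) < 2 ^ L := Nat.two_pow_pos L
  -- The node is the `q`-th of the descendants `d` levels below the row node `2 ^ L + i`. Its
  -- configuration has `q` in the top `d` bits of register `1` and zeros in the bits not yet
  -- rotated.
  have main := opsMap_superpose M (S := fun d q => subtreeSum V (L - d) ((2 ^ L + i) * 2 ^ d + q))
    (c := fun d q => pathConfig M L i (q * 2 ^ (L - d)) (L + d))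
    (ops := fun d => levelOps true 1 (L - 1 - d) (8 + L + d)) (n := L)
    (fun _ _ => subtreeSum_nonneg _ _ _)
    (fun d hd q => by
      rw [show L - d = L - (d + 1) + 1 by omega, subtreeSum]
      congr 2 <;> ring)
    (fun d hd q hq hp => by
      have hS : Selects L 1 (L - 1 - d) (L + d) := ⟨Or.inr ⟨rfl, by omega, by omega⟩⟩
      have e : 2 ^ (L - d) = 2 * 2 ^ (L - 1 - d) := by rw [← pow_succ']; congr 1; omega
      have ej : q * 2 ^ (L - d) = 2 * q * 2 ^ (L - 1 - d) := by rw [e]; ring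
      have b1 : (2 * q + 1 + 1) * 2 ^ (L - 1 - d) ≤ 2 ^ L := by
        calc (2 * q + 1 + 1) * 2 ^ (L - 1 - d) = (q + 1) * 2 ^ (L - d) := by rw [e]; ring
          _ ≤ 2 ^ d * 2 ^ (L - d) := Nat.mul_le_mul_right _ hq
          _ = 2 ^ L := by rw [← pow_add]; congr 1; omega
      have b0 : 0 < 2 ^ (L - 1 - d) := Nat.two_pow_pos _
      have b2 : (2 * q + 1) * 2 ^ (L - 1 - d) < 2 ^ L := by nlinarith
      have b3 : 2 * q * 2 ^ (L - 1 - d) < 2 ^ L := by nlinarith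
      have hh : leafIndex L i (2 * q * 2 ^ (L - 1 - d)) / 2 ^ (2 * L - (L + d)) =
          (2 ^ L + i) * 2 ^ d + q := by
        rw [← ej, show 2 * L - (L + d) = L - d by omega, leafIndex_div_right (by omega),
          show L - (L - d) = d by omega]
      have := opsMap_level_rot I hS hLW hi b3 hi b2 hh bit_false
        (pathConfig_flip_right M (by omega) (by omega))
        (by rwa [show 2 * L - (L + d) = L - d by omega])
      rw [show 2 * L - (L + d) = L - d by omega,
        show 2 * L - (L + d + 1) = L - (d + 1) by omega,
        show 2 * ((2 ^ L + i) * 2 ^ d + q) = (2 ^ L + i) * 2 ^ (d + 1) + 2 * q by ring,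
        ← add_assoc 8] at this
      rw [ej, show L - (d + 1) = L - 1 - d by omega]
      rw [show L - (d + 1) = L - 1 - d by omega] at this
      exact this)
    (by simpa using hpos) le_rfl
  simp only [Nat.sub_self, pow_zero, mul_one, Nat.sub_zero, zero_mul, add_zero, subtreeSum] at main
  have down := opsMap_walk M (r := 0) (D := 0) (d := L) hLW hi hL
    (fun k hk => ⟨Or.inl ⟨rfl, by omega⟩⟩)
  rw [add_zero, zero_add] at down
  rw [rowOps]
  simp only [opsMap_append]
  rw [opsMap_start M hi hL, down, walkOps, main]
  simp only [map_sum, map_smul]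
  refine Finset.sum_congr rfl fun q hq => ?_
  have hq := Finset.mem_range.1 hq
  have hl := le_leafIndex L i q
  have hl2 := leafIndex_lt hi hq
  have up1 := opsMap_unwalk M (r := 1) (D := L + L) (d := L) hLW hi hq (by omega)
    (fun k hk => ⟨Or.inr ⟨rfl, hk, by omega⟩⟩)
  have up0 := opsMap_unwalk M (r := 0) (D := L) (d := L) hLW hi hq le_rfl
    (fun k hk => ⟨Or.inl ⟨rfl, by omega⟩⟩)
  have hp : (pathConfig M L i q (L + L)).word (8 + L + L) =
      nodePointer M (leafIndex L i q) := by
    rw [add_assoc 8, pathConfig_pointer M L i q le_rfl, ← two_mul, Nat.sub_self, pow_zero,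
      Nat.div_one]
  rw [show (2 ^ L + i) * 2 ^ L + q = leafIndex L i q from rfl,
    opsMap_signOps M rfl (X := M.real (nodePointer M (leafIndex L i q))) (by rw [hp])]
  simp only [map_smul]
  rw [add_assoc 8, up1, Nat.add_sub_cancel, up0, Nat.sub_self, opsMap_finish M hi hq, smul_smul,
    ← Complex.ofReal_mul]
  congr 2
  -- If the entry is `0`, the leaf may be missing and the number tested for its sign arbitrary, but
  -- the amplitude vanishes.
  by_cases hV : V (leafIndex L i q) = 0
  · simp [hV]
  · rw [I.leaf_real hl hl2 hV, Real.sqrt_div (sq_nonneg _), Real.sqrt_sq_eq_abs]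
    split_ifs with hs
    · rw [abs_of_neg hs]; ring
    · rw [abs_of_nonneg (not_lt.1 hs)]; ring

/-- Only the upper half of the tree is walked, so the bits of `j` are never read and `j` stays a
spectator. The norms are nonnegative, so no sign step is needed. -/
theorem opsMap_normsOps {M : Memory W} {N k V} {L : ℕ} (I : TreeInv M N k (cellValue (2 * L) V))
    (hLW : 2 * L < W) {j : ℕ} (hj : j < 2 ^ L) (hpos : 0 < subtreeSum V (2 * L) 1) :
    opsMap M (normsOps L) (ket₂ W 0 j) = ∑ q ∈ Finset.range (2 ^ L),
      ((√(subtreeSum V L (2 ^ L + q) / subtreeSum V (2 * L) 1) : ℝ) : ℂ) • ket₂ W q j := by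
  have hL : (0 : ℕ) < 2 ^ L := Nat.two_pow_pos L
  have main := opsMap_superpose M (S := fun d q => subtreeSum V (2 * L - d) (2 ^ d + q))
    (c := fun d q => pathConfig M L (q * 2 ^ (L - d)) j d)
    (ops := fun d => levelOps true 0 (L - 1 - d) (8 + d)) (n := L)
    (fun _ _ => subtreeSum_nonneg _ _ _)
    (fun d hd q => by
      rw [show 2 * L - d = 2 * L - (d + 1) + 1 by omega, subtreeSum]
      congr 2 <;> ring)
    (fun d hd q hq hp => by
      have hS : Selects L 0 (L - 1 - d) d := ⟨Or.inl ⟨rfl, by omega⟩⟩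
      have e : 2 ^ (L - d) = 2 * 2 ^ (L - 1 - d) := by rw [← pow_succ']; congr 1; omega
      have ej : q * 2 ^ (L - d) = 2 * q * 2 ^ (L - 1 - d) := by rw [e]; ring
      have b1 : (2 * q + 1 + 1) * 2 ^ (L - 1 - d) ≤ 2 ^ L := by
        calc (2 * q + 1 + 1) * 2 ^ (L - 1 - d) = (q + 1) * 2 ^ (L - d) := by rw [e]; ring
          _ ≤ 2 ^ d * 2 ^ (L - d) := Nat.mul_le_mul_right _ hq
          _ = 2 ^ L := by rw [← pow_add]; congr 1; omega
      have b0 : 0 < 2 ^ (L - 1 - d) := Nat.two_pow_pos _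
      have b2 : (2 * q + 1) * 2 ^ (L - 1 - d) < 2 ^ L := by nlinarith
      have b3 : 2 * q * 2 ^ (L - 1 - d) < 2 ^ L := by nlinarith
      have hh : leafIndex L (2 * q * 2 ^ (L - 1 - d)) j / 2 ^ (2 * L - d) = 2 ^ d + q := by
        rw [← ej, show 2 * L - d = L + (L - d) by omega, leafIndex_div_left (by omega) hj,
          show L - (L - d) = d by omega]
      have := opsMap_level_rot I hS hLW b3 hj b2 hj hh bit_false
        (pathConfig_flip_left M hj (by omega)) hp
      rw [show 2 * (2 ^ d + q) = 2 ^ (d + 1) + 2 * q by ring] at this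
      rw [ej, show L - (d + 1) = L - 1 - d by omega]
      exact this)
    (by simpa using hpos) le_rfl
  simp only [Nat.sub_self, pow_zero, mul_one, Nat.sub_zero, zero_mul, add_zero,
    show 2 * L - L = L by omega] at main
  rw [normsOps]
  simp only [opsMap_append]
  rw [opsMap_start M hL hj, walkOps, main]
  simp only [map_sum, map_smul]
  refine Finset.sum_congr rfl fun q hq => ?_
  have hq := Finset.mem_range.1 hq
  have up0 := opsMap_unwalk M (r := 0) (D := L) (d := L) hLW hq hj le_rfl
    (fun k hk => ⟨Or.inl ⟨rfl, by omega⟩⟩)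
  rw [up0, Nat.sub_self, opsMap_finish M hq hj]

end

section

/-! ### The data structure -/

/-- The data structure and its algorithms. -/
def treeStructure : DataStructure where
  wordFactor := 15
  insert := insertProgram
  prepareRow := rowProgram
  prepareNorms := normsProgram

/-- The binary length of `m * n`. -/
def sizeLog (m n : ℕ) : ℕ := Nat.log 2 (m * n) + 1

theorem wordSize_eq (m n : ℕ) : treeStructure.wordSize m n = 16 * sizeLog m n := rfl

theorem two_le_sizeLog {m n : ℕ} (h : 2 ≤ m * n) : 2 ≤ sizeLog m n := by
  have := Nat.log_pos (b := 2) (by norm_num) h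
  rw [sizeLog]; omega

theorem mul_lt_two_pow (m n : ℕ) : m * n < 2 ^ sizeLog m n :=
  Nat.lt_pow_succ_log_self (by norm_num) _

theorem rows_lt {m n : ℕ} (h : 2 ≤ m * n) : m < 2 ^ sizeLog m n := by
  have := mul_lt_two_pow m n
  have : 0 < n := Nat.pos_of_ne_zero (by rintro rfl; simp at h)
  nlinarith

theorem cols_lt {m n : ℕ} (h : 2 ≤ m * n) : n < 2 ^ sizeLog m n := by
  have := mul_lt_two_pow m n
  have : 0 < m := Nat.pos_of_ne_zero (by rintro rfl; simp at h)
  nlinarith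

/-- Both `Nat.log 2 (m * n) * log 2` and `log 2` are at most `log (m * n)`, so the factor `2 / log 2
< 3` works. -/
theorem sizeLog_le {m n : ℕ} (h : 2 ≤ m * n) :
    (sizeLog m n : ℝ) ≤ 3 * Real.log ((m : ℝ) * n) := by
  have h2 : (2 : ℝ) ≤ (m : ℝ) * n := by exact_mod_cast h
  have h1 : ((2 : ℝ) ^ Nat.log 2 (m * n)) ≤ (m : ℝ) * n := by
    exact_mod_cast Nat.pow_log_le_self 2 (show m * n ≠ 0 by omega)
  have l1 := Real.log_le_log (by positivity) h1
  have l2 := Real.log_le_log (by norm_num) h2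
  rw [Real.log_pow] at l1
  have := Real.log_two_gt_d9
  have hp : (0 : ℝ) ≤ (Nat.log 2 (m * n) : ℝ) + 1 := by positivity
  rw [sizeLog]; push_cast
  nlinarith

variable {m n : ℕ}

/-- The values at the leaves of the tree after a sequence of arrivals. -/
noncomputable def leafValues (L : ℕ) (es : List (Entry m n)) : ℕ → ℝ :=
  es.foldl (fun V e => Function.update V (leafIndex L e.row e.col) e.val) fun _ => 0

theorem leafValues_append (L : ℕ) (es : List (Entry m n)) (e : Entry m n) :
    leafValues L (es ++ [e]) =
      Function.update (leafValues L es) (leafIndex L e.row e.col) e.val := by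
  simp [leafValues]

theorem leafIndex_inj {L i j i' j' : ℕ} (hj : j < 2 ^ L) (hj' : j' < 2 ^ L) :
    leafIndex L i j = leafIndex L i' j' ↔ i = i' ∧ j = j' := by
  constructor
  · intro h
    have h1 := congrArg (· % 2 ^ L) h
    have h2 := congrArg (· / 2 ^ L) h
    simp only [leafIndex, add_comm _ j, add_comm _ j', Nat.add_mul_mod_self_right,
      Nat.add_mul_div_right _ _ (Nat.two_pow_pos L), Nat.mod_eq_of_lt hj, Nat.mod_eq_of_lt hj',
      Nat.div_eq_of_lt hj, Nat.div_eq_of_lt hj'] at h1 h2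
    omega
  · rintro ⟨rfl, rfl⟩; rfl

theorem leafValues_eq {L : ℕ} (hn : n ≤ 2 ^ L) (es : List (Entry m n)) (i : Fin m) (j : Fin n) :
    leafValues L es (leafIndex L i j) = currentMatrix es i j := by
  induction es using List.reverseRecOn with
  | nil => rfl
  | append_singleton es e ih =>
    rw [leafValues_append, Function.update_apply, ih]
    simp only [leafIndex_inj (j.2.trans_le hn) (e.col.2.trans_le hn)]
    simp [currentMatrix, Fin.ext_iff]

/-- The tree represents a matrix padded to size `2 ^ L` by `2 ^ L`; the padding stays zero and drops
out of all sums. -/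
theorem leafValues_outside {L i j : ℕ} (hn : n ≤ 2 ^ L) (hj : j < 2 ^ L) (es : List (Entry m n))
    (h : m ≤ i ∨ n ≤ j) : leafValues L es (leafIndex L i j) = 0 := by
  induction es using List.reverseRecOn with
  | nil => rfl
  | append_singleton es e ih =>
    rw [leafValues_append, Function.update_of_ne, ih]
    rw [ne_eq, leafIndex_inj hj (e.col.2.trans_le hn)]
    have := e.row.2
    have := e.col.2
    omega

theorem leafValues_fixedPoint {L b s : ℕ} {es : List (Entry m n)}
    (h : ∀ e ∈ es, IsFixedPoint b s e.val) (l : ℕ) : IsFixedPoint b s (leafValues L es l) := by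
  induction es using List.reverseRecOn with
  | nil => exact ⟨0, by positivity, by simp [leafValues]⟩
  | append_singleton es e ih =>
    rw [leafValues_append, Function.update_apply]
    split_ifs
    · exact h e (by simp)
    · exact ih fun e he => h e (by simp [he])

theorem arrivedCount_le (es : List (Entry m n)) : arrivedCount es ≤ m * n :=
  (Finset.card_le_univ _).trans (by simp)

theorem arrivedCount_append (es : List (Entry m n)) (e : Entry m n) :
    arrivedCount es ≤ arrivedCount (es ++ [e]) ∧
      ((∀ e' ∈ es, ¬ (e'.row = e.row ∧ e'.col = e.col)) →
        arrivedCount (es ++ [e]) = arrivedCount es + 1) := by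
  have e1 : ((es ++ [e]).map fun e => (e.row, e.col)).toFinset =
      insert (e.row, e.col) (es.map fun e => (e.row, e.col)).toFinset := by
    ext x; simp [eq_comm]
  constructor
  · rw [arrivedCount, arrivedCount, e1]
    exact Finset.card_le_card (Finset.subset_insert _ _)
  · intro h
    rw [arrivedCount, arrivedCount, e1, Finset.card_insert_of_notMem]
    simpa using h

/-- Addresses must not wrap around: fewer than `2 ^ L` positions with `2 * L` nodes each need at
most `8 * 4 ^ L` addresses, far fewer than a word of `16 * L` bits offers. -/
theorem room {L w : ℕ} (hL : 2 ≤ L) (hw : w < 2 ^ L) {k : ℕ} (hk : k ≤ 2 * L * w) :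
    4 + 2 * (k + 2 * L) ≤ 2 ^ (16 * L) := by
  have h1 : L < 2 ^ L := Nat.lt_two_pow_self
  have h2 : 2 * L * (w + 1) ≤ 2 * 2 ^ L * 2 ^ L := Nat.mul_le_mul (by omega) hw
  have h3 : 8 * (2 ^ L * 2 ^ L) ≤ 2 ^ (16 * L) := by
    rw [← pow_add, show (8 : ℕ) = 2 ^ 3 from rfl, ← pow_add]
    exact Nat.pow_le_pow_right (by norm_num) (by omega)
  nlinarith [Nat.one_le_two_pow (n := L)]

theorem insertRun_spec (h : 2 ≤ m * n) {M : Memory (treeStructure.wordSize m n)} {N k V}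
    (I : TreeInv M N k (cellValue (2 * sizeLog m n) V)) {w : ℕ} (hw : w ≤ m * n)
    (hk : k ≤ 2 * sizeLog m n * w) (e : Entry m n) :
    (treeStructure.insertRun M e).steps ≤ 22 + 80 * sizeLog m n ∧
    ∃ N' k', TreeInv (treeStructure.insertRun M e).mem N' k'
      (cellValue (2 * sizeLog m n)
        (Function.update V (leafIndex (sizeLog m n) e.row e.col) e.val)) ∧
      k' ≤ k + 2 * sizeLog m n ∧ (N (leafIndex (sizeLog m n) e.row e.col) ≠ 0 → k' = k) ∧
      (∀ h, N h ≠ 0 → N' h ≠ 0) ∧ N' (leafIndex (sizeLog m n) e.row e.col) ≠ 0 := by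
  have := insertProgram_run (W := treeStructure.wordSize m n) (two_le_sizeLog h) (wordSize_eq m n)
    (e.row.2.trans (rows_lt h)) (e.col.2.trans (cols_lt h)) (a := e.val)
    (s := { reg := fun r => BitVec.ofNat _
              (([e.row.val, e.col.val, m, n, treeStructure.wordSize m n] : List ℕ).getD r 0)
            realReg := fun r => if r = 0 then e.val else 0
            mem := M
            out := []
            steps := 0 }) rfl rfl rfl rfl rfl I
    (room (two_le_sizeLog h) (hw.trans_lt (mul_lt_two_pow m n)) hk)
  rw [zero_add] at this
  exact this

theorem memory_append (D : DataStructure) (es : List (Entry m n)) (e : Entry m n) :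
    D.memory (es ++ [e]) = (D.insertRun (D.memory es) e).mem := by
  simp [DataStructure.memory]

/-- The memory holds the tree for the current matrix, with at most one path for each position. -/
theorem memory_spec (h : 2 ≤ m * n) (es : List (Entry m n)) :
    ∃ N k, TreeInv (treeStructure.memory es) N k
        (cellValue (2 * sizeLog m n) (leafValues (sizeLog m n) es)) ∧
      k ≤ 2 * sizeLog m n * arrivedCount es ∧
      ∀ e ∈ es, N (leafIndex (sizeLog m n) e.row e.col) ≠ 0 := by
  induction es using List.reverseRecOn with
  | nil =>
    refine ⟨Function.update 0 1 2, 0, ?_, Nat.zero_le _, by simp⟩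
    have hz : cellValue (2 * sizeLog m n) (leafValues (sizeLog m n) ([] : List (Entry m n))) =
        fun _ => 0 := funext fun h => cellValue_zero _ _
    rw [hz]
    refine treeInv_blank ?_
    calc 4 = 2 ^ 2 := rfl
      _ ≤ 2 ^ treeStructure.wordSize m n :=
        Nat.pow_le_pow_right (by norm_num) (by
          have := two_le_sizeLog h
          rw [wordSize_eq]; omega)
  | append_singleton es e ih =>
    obtain ⟨N, k, I, hk, hN⟩ := ih
    obtain ⟨-, N', k', I', h1, h2, h3, h4⟩ := insertRun_spec h I (arrivedCount_le es) hk e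
    obtain ⟨c1, c2⟩ := arrivedCount_append es e
    refine ⟨N', k', ?_, ?_, ?_⟩
    · rw [memory_append, leafValues_append]
      exact I'
    -- A missing leaf means that the position is new, so the count of positions grows and pays for
    -- up to `2 * L` nodes. Otherwise no node is created.
    · by_cases hl : N (leafIndex (sizeLog m n) e.row e.col) = 0
      · rw [c2 fun e' he' hc => hN e' he' (by rw [hc.1, hc.2, hl])]
        rw [mul_add, mul_one]; omega
      · rw [h2 hl]
        exact hk.trans (Nat.mul_le_mul_left _ c1)
    · intro e' he'
      rcases List.mem_append.1 he' with he' | he'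
      · exact h3 _ (hN e' he')
      · rw [List.mem_singleton.1 he']; exact h4

theorem memory_size (h : 2 ≤ m * n) (es : List (Entry m n)) :
    (treeStructure.memory es).size ≤ 256 * (arrivedCount es * sizeLog m n ^ 2) := by
  obtain ⟨N, k, I, hk, -⟩ := memory_spec h es
  -- With no arrivals the bound is `0`, so the counter and the root record cannot be charged; the
  -- memory is then really blank. Otherwise they are absorbed by the first position.
  rcases es with _ | ⟨e, es⟩
  · have h1 : (Memory.blank (treeStructure.wordSize m n)).wordCells = 0 :=
      Nat.le_zero.1 (Nat.sInf_le fun _ _ => rfl)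
    have h2 : (Memory.blank (treeStructure.wordSize m n)).realCells = 0 :=
      Nat.le_zero.1 (Nat.sInf_le fun _ _ => rfl)
    have : (treeStructure.memory ([] : List (Entry m n))).size = 0 := by
      change (Memory.blank (treeStructure.wordSize m n)).size = 0
      rw [Memory.size, h1, h2, zero_add, zero_mul]
    rw [this]; exact Nat.zero_le _
  · refine I.size_le.trans ?_
    have hw : 1 ≤ arrivedCount (e :: es) :=
      Finset.card_pos.2 ⟨(e.row, e.col), by simp⟩
    have hL := two_le_sizeLog h
    rw [wordSize_eq]
    generalize arrivedCount (e :: es) = w at *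
    generalize sizeLog m n = L at *
    have : 4 + 2 * k ≤ 8 * (L * w) := by nlinarith
    calc 2 * (4 + 2 * k) * (16 * L) ≤ 2 * (8 * (L * w)) * (16 * L) := by gcongr
      _ = 256 * (w * L ^ 2) := by ring

theorem insertTime_le (h : 2 ≤ m * n) (es : List (Entry m n)) (e : Entry m n) :
    treeStructure.insertTime es e ≤ 1632 * sizeLog m n ^ 2 := by
  obtain ⟨N, k, I, hk, -⟩ := memory_spec h es
  have hs := (insertRun_spec h I (arrivedCount_le es) hk e).1
  have hL := two_le_sizeLog h
  calc treeStructure.insertTime es e ≤ 16 * sizeLog m n * (22 + 80 * sizeLog m n) := Nat.mul_le_mul_left _ hs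
    _ ≤ _ := by nlinarith

theorem controlRun_row (h : 2 ≤ m * n) :
    (treeStructure.controlRun rowProgram m n).out = rowOps (sizeLog m n) ∧
    (treeStructure.controlRun rowProgram m n).steps ≤ 30 + 120 * sizeLog m n := by
  have := rowProgram_run (W := treeStructure.wordSize m n) (L := sizeLog m n)
    (by have := two_le_sizeLog h; omega) (wordSize_eq m n)
    (s := { reg := fun r => BitVec.ofNat _
              (([m, n, treeStructure.wordSize m n] : List ℕ).getD r 0)
            realReg := fun _ => 0
            mem := Memory.blank _
            out := []
            steps := 0 }) rfl rfl rfl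
  rw [zero_add] at this
  exact this

theorem controlRun_norms (h : 2 ≤ m * n) :
    (treeStructure.controlRun normsProgram m n).out = normsOps (sizeLog m n) ∧
    (treeStructure.controlRun normsProgram m n).steps ≤ 30 + 120 * sizeLog m n := by
  have := normsProgram_run (W := treeStructure.wordSize m n) (L := sizeLog m n)
    (by have := two_le_sizeLog h; omega) (wordSize_eq m n)
    (s := { reg := fun r => BitVec.ofNat _
              (([m, n, treeStructure.wordSize m n] : List ℕ).getD r 0)
            realReg := fun _ => 0
            mem := Memory.blank _
            out := []
            steps := 0 }) rfl rfl rfl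
  rw [zero_add] at this
  exact this

theorem quantumTime_le {p : Cmd} (h : 2 ≤ m * n)
    (hs : (treeStructure.controlRun p m n).steps ≤ 30 + 120 * sizeLog m n)
    (ho : (treeStructure.controlRun p m n).out.length ≤ 7 + 64 * sizeLog m n) :
    treeStructure.quantumTime p m n ≤ 3600 * sizeLog m n ^ 2 := by
  have hL := two_le_sizeLog h
  calc treeStructure.quantumTime p m n ≤ 16 * sizeLog m n * ((30 + 120 * sizeLog m n) + (7 + 64 * sizeLog m n)) :=
        Nat.mul_le_mul_left _ (add_le_add hs ho)
    _ ≤ _ := by nlinarith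

/-! ### Amplitudes -/

theorem sum_range_eq_sum_fin {E : Type*} [AddCommMonoid E] {K N : ℕ} (f : ℕ → E) (hN : N ≤ K)
    (hf : ∀ q, N ≤ q → q < K → f q = 0) : ∑ q ∈ Finset.range K, f q = ∑ q : Fin N, f q := by
  rw [← Finset.sum_range fun q => f q]
  refine (Finset.sum_subset (Finset.range_subset_range.2 hN) fun q h1 h2 => ?_).symm
  rw [Finset.mem_range] at h1 h2
  exact hf q (by omega) h1

theorem rowNorms_sq (A : Matrix (Fin m) (Fin n) ℝ) (i : Fin m) :
    rowNorms A i ^ 2 = ∑ j, A i j ^ 2 := by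
  rw [rowNorms, EuclideanSpace.norm_sq_eq]
  simp

theorem subtreeSum_row {L : ℕ} (hn : n ≤ 2 ^ L) (es : List (Entry m n)) (i : Fin m) :
    subtreeSum (leafValues L es) L (2 ^ L + i) = rowNorms (currentMatrix es) i ^ 2 := by
  have := subtreeSum_add (leafValues L es) L 0 (2 ^ L + i)
  rw [zero_add] at this
  rw [this, rowNorms_sq, sum_range_eq_sum_fin _ hn]
  · refine Finset.sum_congr rfl fun j _ => ?_
    rw [← leafValues_eq hn]; rfl
  · intro q h1 h2
    change leafValues L es (leafIndex L i q) ^ 2 = 0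
    rw [leafValues_outside hn h2 es (Or.inr h1)]; norm_num

theorem subtreeSum_outside {L i : ℕ} (hn : n ≤ 2 ^ L) (es : List (Entry m n)) (hi : m ≤ i) :
    subtreeSum (leafValues L es) L (2 ^ L + i) = 0 := by
  have := subtreeSum_add (leafValues L es) L 0 (2 ^ L + i)
  rw [zero_add] at this
  rw [this]
  refine Finset.sum_eq_zero fun q hq => ?_
  change leafValues L es (leafIndex L i q) ^ 2 = 0
  rw [leafValues_outside hn (Finset.mem_range.1 hq) es (Or.inl hi)]; norm_num

theorem norm_rowNorms_sq (A : Matrix (Fin m) (Fin n) ℝ) :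
    ‖WithLp.toLp 2 (rowNorms A)‖ ^ 2 = ∑ i, rowNorms A i ^ 2 := by
  rw [EuclideanSpace.norm_sq_eq]
  simp

theorem subtreeSum_root {L : ℕ} (hm : m ≤ 2 ^ L) (hn : n ≤ 2 ^ L) (es : List (Entry m n)) :
    subtreeSum (leafValues L es) (2 * L) 1 =
      ‖WithLp.toLp 2 (rowNorms (currentMatrix es))‖ ^ 2 := by
  rw [two_mul, subtreeSum_add, norm_rowNorms_sq, one_mul, sum_range_eq_sum_fin _ hm]
  · exact Finset.sum_congr rfl fun i _ => subtreeSum_row hn es i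
  · exact fun q h1 _ => subtreeSum_outside hn es h1

theorem quantumRun_row (h : 2 ≤ m * n) (es : List (Entry m n)) (i : Fin m)
    (hi : currentMatrix es i ≠ 0) :
    treeStructure.quantumRun rowProgram es (ket₂ _ i 0) =
      ∑ j : Fin n, amplitude (currentMatrix es i) j • ket₂ _ i j := by
  obtain ⟨N, k, I, -⟩ := memory_spec h es
  have hn := (cols_lt h).le
  have hL := two_le_sizeLog h
  have hs := subtreeSum_row hn es i
  have hpos : 0 < rowNorms (currentMatrix es) i :=
    norm_pos_iff.2 fun h0 => hi ((WithLp.toLp_eq_zero 2).1 h0)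
  rw [DataStructure.quantumRun, (controlRun_row h).1, applyAll_eq,
    opsMap_rowOps I (by rw [wordSize_eq]; omega) (i.2.trans (rows_lt h))
      (by rw [hs]; positivity), hs, Real.sqrt_sq hpos.le, sum_range_eq_sum_fin _ hn]
  · refine Finset.sum_congr rfl fun j _ => ?_
    rw [leafValues_eq hn]; rfl
  · intro q h1 h2
    rw [leafValues_outside hn h2 es (Or.inr h1)]
    simp

theorem quantumRun_norms (h : 2 ≤ m * n) (es : List (Entry m n)) (hA : currentMatrix es ≠ 0)
    (j : Fin n) : treeStructure.quantumRun normsProgram es (ket₂ _ 0 j) =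
      ∑ i : Fin m, amplitude (rowNorms (currentMatrix es)) i • ket₂ _ i j := by
  obtain ⟨N, k, I, -⟩ := memory_spec h es
  have hn := (cols_lt h).le
  have hm := (rows_lt h).le
  have hL := two_le_sizeLog h
  have hs := subtreeSum_root hm hn es
  have hpos : 0 < ‖WithLp.toLp 2 (rowNorms (currentMatrix es))‖ := by
    refine norm_pos_iff.2 fun h0 => hA ?_
    have h0 := (WithLp.toLp_eq_zero 2).1 h0
    funext i
    exact (WithLp.toLp_eq_zero 2).1 (norm_eq_zero.1 (congrFun h0 i))
  rw [DataStructure.quantumRun, (controlRun_norms h).1, applyAll_eq,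
    opsMap_normsOps I (by rw [wordSize_eq]; omega) (j.2.trans (cols_lt h))
      (by rw [hs]; positivity), hs, sum_range_eq_sum_fin _ hm]
  · refine Finset.sum_congr rfl fun i _ => ?_
    -- The weights are squared norms, so the square root of their quotient is the amplitude itself.
    rw [subtreeSum_row hn, Real.sqrt_div (sq_nonneg _), Real.sqrt_sq hpos.le,
      Real.sqrt_sq (show 0 ≤ rowNorms (currentMatrix es) i from norm_nonneg _)]
    rfl
  · intro q h1 h2
    rw [subtreeSum_outside hn es h1]
    simp

theorem cast_le_of_sizeLog (h : 2 ≤ m * n) {x a : ℕ} (hx : x ≤ 3600 * (a * sizeLog m n ^ 2)) :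
    (x : ℝ) ≤ 40000 * (a * Real.log ((m : ℝ) * n) ^ 2) := by
  have h1 : (x : ℝ) ≤ 3600 * (a * (sizeLog m n : ℝ) ^ 2) := by exact_mod_cast hx
  have h2 : (sizeLog m n : ℝ) ^ 2 ≤ (3 * Real.log ((m : ℝ) * n)) ^ 2 :=
    pow_le_pow_left₀ (Nat.cast_nonneg _) (sizeLog_le h) 2
  have h3 := mul_le_mul_of_nonneg_left h2 (Nat.cast_nonneg (α := ℝ) a)
  have h4 : 0 ≤ (a : ℝ) * Real.log ((m : ℝ) * n) ^ 2 := by positivity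
  nlinarith

end

end QDS

/-! ### The main theorem -/

open QDS
theorem mainTheorem8 :
    ∃ (D : DataStructure) (C : ℝ) (c : ℕ), ∀ m n : ℕ, 2 ≤ m * n →
      -- running times of the two quantum algorithms
      (D.quantumTime D.prepareRow m n : ℝ) ≤ C * Real.log (m * n) ^ c ∧
      (D.quantumTime D.prepareNorms m n : ℝ) ≤ C * Real.log (m * n) ^ c ∧
      ∀ es : List (Entry m n),
        -- size
        ((D.memory es).size : ℝ) ≤ C * (arrivedCount es * Real.log (m * n) ^ 2) ∧
        -- numbers with few bits are stored with few bits
        (∀ b s : ℕ, (∀ e ∈ es, IsFixedPoint b s e.val) → ∀ a,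
          ∃ b' s' : ℕ, (b' : ℝ) ≤ C * (b + Real.log (m * n)) ∧ s' ≤ 2 * s ∧
            IsFixedPoint b' s' ((D.memory es).real a)) ∧
        -- time to store a new entry
        (∀ e : Entry m n, (D.insertTime es e : ℝ) ≤ C * Real.log (m * n) ^ 2) ∧
        -- the mapping that prepares the rows
        (∀ i : Fin m, currentMatrix es i ≠ 0 →
          D.quantumRun D.prepareRow es (ket₂ _ i 0) =
            ∑ j : Fin n, amplitude (currentMatrix es i) j • ket₂ _ i j) ∧
        -- the mapping that prepares the vector of row norms
        (currentMatrix es ≠ 0 → ∀ j : Fin n,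
          D.quantumRun D.prepareNorms es (ket₂ _ 0 j) =
            ∑ i : Fin m, amplitude (rowNorms (currentMatrix es)) i • ket₂ _ i j) := by
  -- All costs are at most `3600 * L ^ 2`, times the number of positions for the size, and `L` is at
  -- most three logarithms: `3600 * 9 = 32400`.
  refine ⟨treeStructure, 40000, 2, fun m n h => ?_⟩
  have time : ∀ x : ℕ, x ≤ 3600 * sizeLog m n ^ 2 →
      (x : ℝ) ≤ 40000 * Real.log ((m : ℝ) * n) ^ 2 := fun x hx => by
    simpa using cast_le_of_sizeLog h (x := x) (a := 1) (by simpa using hx)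
  refine ⟨time _ (quantumTime_le h (controlRun_row h).2 ?_),
    time _ (quantumTime_le h (controlRun_norms h).2 ?_), fun es => ⟨?_, ?_, ?_, ?_, ?_⟩⟩
  · exact (congrArg List.length (controlRun_row h).1).trans_le (rowOps_length _)
  · exact (congrArg List.length (controlRun_norms h).1).trans_le (normsOps_length _)
  · exact cast_le_of_sizeLog h ((memory_size h es).trans (by gcongr; norm_num))
  · intro b s hb a
    obtain ⟨N, k, I, -⟩ := memory_spec h es
    have hlog := sizeLog_le h
    have hlog0 : (0 : ℝ) ≤ Real.log ((m : ℝ) * n) := by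
      have : (0 : ℝ) ≤ (sizeLog m n : ℝ) := Nat.cast_nonneg _
      linarith
    have hb0 : (0 : ℝ) ≤ (b : ℝ) := Nat.cast_nonneg _
    -- Squares take `2 * b` bits, and summing through the `2 * L` levels of the tree adds at most
    -- one bit per level.
    have bound : ((2 * b + 2 * sizeLog m n : ℕ) : ℝ) ≤
        40000 * (b + Real.log ((m : ℝ) * n)) := by
      push_cast; linarith
    rcases I.real_eq a with h0 | ⟨x, hx⟩
    · refine ⟨_, s, bound, by omega, 0, by positivity, by simp [h0]⟩
    · obtain ⟨s', h1, h2⟩ := cellValue_fixedPoint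
        (leafValues_fixedPoint (L := sizeLog m n) hb) (2 * sizeLog m n) x
      exact ⟨_, s', bound, h1, by rw [hx]; exact h2⟩
  · exact fun e => time _ ((insertTime_le h es e).trans (by gcongr; norm_num))
  · exact fun i hi => quantumRun_row h es i hi
  · exact fun hA j => quantumRun_norms h es hA j
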